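/- Let $\mathbb F$ be a $p$-adic field (a finite extension of $\mathbb Q_p$) with ring of integers $\mathfrak o$ and prime element $\varpi$, let $\Lambda\subseteq\mathbb F^\times$ be a subgroup of finite index containing $\varpi$, and let $\chi:\mathbb F\to\mathbb C^\times$ be an additive character of conductor $\mathfrak o$, i.e. for $a\in\mathbb F$, $\chi$ is trivial on $a\mathfrak o$ if and only if $a\in\mathfrak o$. Put $x\cdot\xi=\sum_i x_i\xi_i$ on $\mathbb F^n$, use the maximum norm, and let $dx$ be the Haar measure with $\int_{\mathfrak o^n}dx=1$. For $X\subseteq\mathbb F^n$ open let $C^\infty(X)$ be the space of locally constant functions $X\to\mathbb C$, $\mathcal S(X)$ the space of locally constant functions with compact support in $X$, and $\mathcal S^*(X)$ the linear dual of $\mathcal S(X)$; $C^\infty(X)$ is embedded in $\mathcal S^*(X)$ by $g\mapsto g\,dx$. For $u\in\mathcal S^*(X)$ and $\phi\in\mathcal S(X)$ put $\mathcal F(\phi u)(\xi)=u(\chi(-\,\cdot\,\xi)\phi)$. A cone in $\mathbb F^n\setminus 0$ is a subset stable under multiplication by $\Lambda$. For $A\subseteq\mathbb F^n$ let $\mathrm{AC}(A)$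 be the set of $\xi\in\mathbb F^n\setminus0$ such that every open cone containing $\xi$ meets $A$ in an unbounded set. The wave front set of $u\in\mathcal S^*(X)$ is \[ \mathrm{WF}(u)=\{(x,\xi)\in X\times(\mathbb F^n\setminus0);\ \xi\in\mathrm{AC}(\mathrm{supp}\,\mathcal F(\phi u))\ \text{for all}\ \phi\in\mathcal S(X)\ \text{with}\ \phi(x)\neq0\}. \] A closed cone $\Gamma\subseteq X\times(\mathbb F^n\setminus0)$ is a relatively closed subset such that $(x,\xi)\in\Gamma\iff(x,\lambda\xi)\in\Gamma$ for all $\lambda\in\Lambda$. Let $\mathcal S^*_\Gamma(X)=\{u\in\mathcal S^*(X);\ \mathrm{WF}(u)\subseteq\Gamma\}$. A sequence $u_j\in\mathcal S^*_\Gamma(X)$ converges to $u\in\mathcal S^*_\Gamma(X)$ if $u_j(\phi)\to u(\phi)$ for every $\phi\in\mathcal S(X)$ and if, for every $\phi\in\mathcal S(X)$ and every relatively closed cone $V\subseteq\mathbb F^n\setminus0$ with $\Gamma\cap(\mathrm{supp}\,\phi\times V)=\emptyset$, the set $\bigcup_j\mathrm{supp}\,\mathcal F(\phi u_j)\cap V$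 is bounded. A map between such spaces is called continuous if it preserves convergence of sequences (with their limits). **Theorem.** Let $X\subseteq\mathbb F^m$ and $Y\subseteq\mathbb F^n$ be open, let $f:X\to Y$ be (locally) analytic with derivative $f'(x)$, and set \[ N_f=\{(f(x),\eta)\in Y\times(\mathbb F^n\setminus0);\ x\in X,\ f'(x)^t\eta=0\}. \] Let $\Gamma\subseteq Y\times(\mathbb F^n\setminus0)$ be a closed cone with $\Gamma\cap N_f=\emptyset$, and for $\Gamma'\subseteq\Gamma$ put \[ f^*\Gamma'=\{(x,f'(x)^t\eta);\ x\in X,\ (f(x),\eta)\in\Gamma'\}. \] Then $C^\infty(Y)\subseteq\mathcal S^*_\Gamma(Y)$, $f^*\Gamma$ is a closed cone in $X\times(\mathbb F^m\setminus0)$, and the map $f^*:C^\infty(Y)\to C^\infty(X)$, $f^*(u)=u\circ f$, extends uniquely to a continuous map \[ f^*:\mathcal S^*_\Gamma(Y)\to\mathcal S^*_{f^*\Gamma}(X). \] Moreover $\mathrm{WF}(f^*u)\subseteq f^*\,\mathrm{WF}(u)$ for all $u\in\mathcal S^*_\Gamma(Y)$. -/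

import Mathlib

open Set Filter Topology MeasureTheory Matrix

namespace PadicWF

/-- An additive character `χ : F → ℂˣ` of conductor `𝔬 = {‖x‖ ≤ 1}`: the largest fractional ideal
`a𝔬` on which `χ` is trivial is `𝔬` itself. -/
structure StdChar (F : Type*) [NormedField F] where
  /-- the underlying additive character -/
  toAddChar : AddChar F ℂ
  /-- `χ` is trivial on `a𝔬` exactly when `a ∈ 𝔬` -/
  conductor : ∀ a : F, (∀ x : F, ‖x‖ ≤ 1 → toAddChar (a * x) = 1) ↔ ‖a‖ ≤ 1

/-- `ϖ` generates the maximal ideal `{‖x‖ < 1}` of the ring of integers. -/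
def IsPrimeElement {F : Type*} [NormedField F] (ϖ : Fˣ) : Prop :=
  ‖(ϖ : F)‖ < 1 ∧ ∀ x : F, ‖x‖ < 1 → ‖x‖ ≤ ‖(ϖ : F)‖

section Functions

variable {F : Type*} [NontriviallyNormedField F] {m n : ℕ}

/-- The space `C^∞(X)` of functions that are locally constant on the open set `X ⊆ Fⁿ`. A function
on `X` is represented by a function on `Fⁿ` whose values outside `X` play no role. -/
def Smooth (X : Set (Fin n → F)) : Submodule ℂ ((Fin n → F) → ℂ) where
  carrier := {g | ∀ x ∈ X, ∀ᶠ y in 𝓝 x, g y = g x}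
  add_mem' := by
    intro a b ha hb x hx
    filter_upwards [ha x hx, hb x hx] with y h1 h2
    simp [h1, h2]
  zero_mem' := by
    intro x _
    simp
  smul_mem' := by
    intro c a ha x hx
    filter_upwards [ha x hx] with y h1
    simp [h1]

/-- The Schwartz-Bruhat space `𝓢(X)`: locally constant functions on `Fⁿ` whose support is compact
and contained in `X`. -/
def SB (X : Set (Fin n → F)) : Submodule ℂ ((Fin n → F) → ℂ) where
  carrier := {φ | IsLocallyConstant φ ∧ HasCompactSupport φ ∧ tsupport φ ⊆ X}
  add_mem' := by
    rintro a b ⟨ha, ha', ha''⟩ ⟨hb, hb', hb''⟩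
    exact ⟨ha.add hb, ha'.add hb', (tsupport_add a b).trans (union_subset ha'' hb'')⟩
  zero_mem' := by
    refine ⟨IsLocallyConstant.const 0, HasCompactSupport.zero, ?_⟩
    simp
  smul_mem' := by
    rintro c a ⟨ha, ha', ha''⟩
    refine ⟨ha.comp (fun z => c • z), ha'.smul_left (f := fun _ => c), ?_⟩
    exact (tsupport_smul_subset_right (fun _ => c) a).trans ha''

/-- Multiplication `φ ↦ gφ` of a test function by a smooth function. -/
def mulSB {X : Set (Fin n → F)} (g : Smooth X) : SB X →ₗ[ℂ] SB X where
  toFun φ := ⟨fun x => g.1 x * φ.1 x, by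
    obtain ⟨φ, h1, h2, h3⟩ := φ
    have hs : tsupport (fun x => g.1 x * φ x) ⊆ tsupport φ := tsupport_mul_subset_right
    refine ⟨?_, h2.mul_left, hs.trans h3⟩
    rw [IsLocallyConstant.iff_eventually_eq]
    intro x
    by_cases hx : x ∈ tsupport φ
    · filter_upwards [g.2 x (h3 hx), (IsLocallyConstant.iff_eventually_eq φ).1 h1 x] with y e1 e2
      rw [e1, e2]
    · have hev : ∀ᶠ y in 𝓝 x, y ∉ tsupport φ := (isClosed_tsupport φ).isOpen_compl.mem_nhds hx
      filter_upwards [hev] with y hy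
      simp [image_eq_zero_of_notMem_tsupport hy, image_eq_zero_of_notMem_tsupport hx]⟩
  map_add' a b := by
    ext x
    simp [mul_add]
  map_smul' c a := by
    ext x
    simp [mul_left_comm]

/-- The pullback `f^* : C^∞(Y) → C^∞(X)`, `g ↦ g ∘ f`. -/
def pullbackSmooth {X : Set (Fin m → F)} {Y : Set (Fin n → F)} {f : (Fin m → F) → (Fin n → F)}
    (hf : AnalyticOnNhd F f X) (hXY : MapsTo f X Y) (g : Smooth Y) : Smooth X :=
  ⟨g.1 ∘ f, fun x hx => (hf x hx).continuousAt.eventually (g.2 (f x) (hXY hx))⟩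

/-- The smooth function `x ↦ χ(-x·ξ)`. -/
def charFn (χ : StdChar F) (X : Set (Fin n → F)) (ξ : Fin n → F) : Smooth X :=
  ⟨fun x => χ.toAddChar (-(x ⬝ᵥ ξ)), by
    intro x _
    have hc : Continuous fun y : Fin n → F => ‖(x - y) ⬝ᵥ ξ‖ := by
      unfold dotProduct
      fun_prop
    have h0 : ‖(x - x) ⬝ᵥ ξ‖ < 1 := by simp
    filter_upwards [(isOpen_lt hc continuous_const).mem_nhds h0] with y hy
    have h1 : χ.toAddChar ((x - y) ⬝ᵥ ξ) = 1 := by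
      have h := (χ.conductor 1).2 (by simp) ((x - y) ⬝ᵥ ξ) (le_of_lt hy)
      simpa using h
    have h2 : -(y ⬝ᵥ ξ) = -(x ⬝ᵥ ξ) + (x - y) ⬝ᵥ ξ := by
      rw [sub_dotProduct]
      ring
    rw [h2, AddChar.map_add_eq_mul, h1, mul_one]⟩

end Functions

section Integration

variable {F : Type*} [NontriviallyNormedField F] [ProperSpace F] [MeasurableSpace F] [BorelSpace F]

/-- The compact set `𝔬ⁿ ⊆ Fⁿ` (the norm on `Fⁿ` is the maximum norm). -/
def integerBox (F : Type*) [NontriviallyNormedField F] [ProperSpace F] (n : ℕ) :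
    TopologicalSpace.PositiveCompacts (Fin n → F) where
  carrier := Metric.closedBall 0 1
  isCompact' := isCompact_closedBall 0 1
  interior_nonempty' :=
    ⟨0, Metric.ball_subset_interior_closedBall (Metric.mem_ball_self one_pos)⟩

/-- The Haar measure `dx` on `Fⁿ` that gives `𝔬ⁿ` volume one; this is the normalization for which
Fourier inversion holds for a character of conductor `𝔬`. -/
noncomputable def haar (F : Type*) [NontriviallyNormedField F] [ProperSpace F] [MeasurableSpace F]
    [BorelSpace F] (n : ℕ) : Measure (Fin n → F) :=
  Measure.addHaarMeasure (integerBox F n)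

theorem SB.integrable {n : ℕ} {X : Set (Fin n → F)} (φ : SB X) : Integrable φ.1 (haar F n) := by
  unfold haar
  exact φ.2.1.continuous.integrable_of_hasCompactSupport φ.2.2.1

/-- `φ ↦ ∫ φ(x) dx` as a linear functional on `𝓢(X)`. -/
noncomputable def integralSB {n : ℕ} (X : Set (Fin n → F)) : SB X →ₗ[ℂ] ℂ where
  toFun φ := ∫ x, φ.1 x ∂(haar F n)
  map_add' a b := integral_add (SB.integrable a) (SB.integrable b)
  map_smul' c a := integral_smul c a.1

end Integration

section Distributions

variable {F : Type*} [NontriviallyNormedField F] {m n : ℕ}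

/-- The space `𝓢^*(X)` of distributions: the linear dual of `𝓢(X)`. -/
abbrev Dist (X : Set (Fin n → F)) : Type _ := SB X →ₗ[ℂ] ℂ

/-- The distribution `g dx`, i.e. `φ ↦ ∫ g(x) φ(x) dx`, given by a smooth function `g`. -/
noncomputable def ofSmooth [ProperSpace F] [MeasurableSpace F] [BorelSpace F]
    {X : Set (Fin n → F)} (g : Smooth X) : Dist X :=
  integralSB X ∘ₗ mulSB g

/-- The Fourier transform of the compactly supported distribution `φu`, where `φ ∈ 𝓢(X)` and
`u ∈ 𝓢^*(X)`: `𝓕(φu)(ξ) = (φu)(χ(-·ξ)) = u(χ(-·ξ) φ)`. -/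
noncomputable def fourierMul (χ : StdChar F) {X : Set (Fin n → F)} (φ : SB X) (u : Dist X)
    (ξ : Fin n → F) : ℂ :=
  u (mulSB (charFn χ X ξ) φ)

/-- A cone in `Fⁿ ∖ 0`: a subset closed under multiplication by `Λ`. -/
def IsCone (Λ : Subgroup Fˣ) (V : Set (Fin n → F)) : Prop :=
  (∀ ξ ∈ V, ξ ≠ 0) ∧ ∀ l ∈ Λ, ∀ ξ ∈ V, (l : F) • ξ ∈ V

/-- A cone that is closed as a subset of `Fⁿ ∖ 0`. -/
def IsClosedCone (Λ : Subgroup Fˣ) (V : Set (Fin n → F)) : Prop :=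
  IsCone Λ V ∧ ∀ ξ ∈ closure V, ξ ≠ 0 → ξ ∈ V

/-- The asymptotic cone `AC(A)`: the nonzero `ξ` such that every open cone containing `ξ` meets `A`
in an unbounded set. -/
def asymptoticCone (Λ : Subgroup Fˣ) (A : Set (Fin n → F)) : Set (Fin n → F) :=
  {ξ | ξ ≠ 0 ∧ ∀ V : Set (Fin n → F), IsOpen V → IsCone Λ V → ξ ∈ V →
    ¬ Bornology.IsBounded (A ∩ V)}

/-- The wave front set of `u ∈ 𝓢^*(X)`: the pairs `(x, ξ)`, `x ∈ X`, `ξ ≠ 0`, such that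
`ξ ∈ Σ(φu) = AC(supp 𝓕(φu))` for all `φ ∈ 𝓢(X)` with `φ(x) ≠ 0`. -/
def WF (χ : StdChar F) (Λ : Subgroup Fˣ) {X : Set (Fin n → F)} (u : Dist X) :
    Set ((Fin n → F) × (Fin n → F)) :=
  {z | z.1 ∈ X ∧ z.2 ≠ 0 ∧
    ∀ φ : SB X, φ.1 z.1 ≠ 0 → z.2 ∈ asymptoticCone Λ (tsupport (fourierMul χ φ u))}

/-- `Γ` is a cone in `X × (Fⁿ ∖ 0)` that is closed in `X × (Fⁿ ∖ 0)`. -/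
structure IsClosedConeOver (Λ : Subgroup Fˣ) (X : Set (Fin n → F))
    (Γ : Set ((Fin n → F) × (Fin n → F))) : Prop where
  subset : Γ ⊆ X ×ˢ {0}ᶜ
  cone : ∀ l ∈ Λ, ∀ x ξ : Fin n → F, (x, ξ) ∈ Γ ↔ (x, (l : F) • ξ) ∈ Γ
  closed : closure Γ ∩ X ×ˢ {0}ᶜ ⊆ Γ

/-- `𝓢^*_Γ(X)`: the distributions on `X` whose wave front set is contained in `Γ`. -/
def DistWF (χ : StdChar F) (Λ : Subgroup Fˣ) (X : Set (Fin n → F))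
    (Γ : Set ((Fin n → F) × (Fin n → F))) : Set (Dist X) :=
  {u | WF χ Λ u ⊆ Γ}

/-- Convergence of a sequence `u_j → u` in `𝓢^*_Γ(X)`: weak convergence, and for every `φ ∈ 𝓢(X)`
and every closed cone `V ⊆ Fⁿ ∖ 0` with `Γ ∩ (supp φ × V) = ∅`, the set
`⋃_j supp 𝓕(φu_j) ∩ V` is bounded. -/
def ConvergesTo (χ : StdChar F) (Λ : Subgroup Fˣ) {X : Set (Fin n → F)}
    {Γ : Set ((Fin n → F) × (Fin n → F))} (u : ℕ → DistWF χ Λ X Γ) (v : DistWF χ Λ X Γ) : Prop :=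
  (∀ φ : SB X, Tendsto (fun j => (u j).1 φ) atTop (𝓝 (v.1 φ))) ∧
  ∀ (φ : SB X) (V : Set (Fin n → F)), IsClosedCone Λ V → Γ ∩ tsupport φ.1 ×ˢ V = ∅ →
    Bornology.IsBounded ((⋃ j, tsupport (fourierMul χ φ (u j).1)) ∩ V)

/-- The map is continuous for the convergence of sequences in `𝓢^*_Γ(Y)` and `𝓢^*_{Γ'}(X)`. -/
def IsContinuous (χ : StdChar F) (Λ : Subgroup Fˣ) {X : Set (Fin m → F)} {Y : Set (Fin n → F)}
    {Γ : Set ((Fin n → F) × (Fin n → F))} {Γ' : Set ((Fin m → F) × (Fin m → F))}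
    (T : DistWF χ Λ Y Γ → DistWF χ Λ X Γ') : Prop :=
  ∀ (u : ℕ → DistWF χ Λ Y Γ) (v : DistWF χ Λ Y Γ),
    ConvergesTo χ Λ u v → ConvergesTo χ Λ (fun j => T (u j)) (T v)

/-- `f'(x)^t η`, the transposed Jacobian matrix of `f` at `x` applied to `η`. -/
noncomputable def codiff (f : (Fin m → F) → (Fin n → F)) (x : Fin m → F) (η : Fin n → F) :
    Fin m → F :=
  (LinearMap.toMatrix' (fderiv F f x : (Fin m → F) →ₗ[F] (Fin n → F)))ᵀ *ᵥ η

/-- `N_f = {(f(x), η) ; x ∈ X, η ≠ 0, f'(x)^t η = 0}`. -/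
def normalSet (f : (Fin m → F) → (Fin n → F)) (X : Set (Fin m → F)) :
    Set ((Fin n → F) × (Fin n → F)) :=
  {z | ∃ x ∈ X, z.1 = f x ∧ z.2 ≠ 0 ∧ codiff f x z.2 = 0}

/-- `f^*Γ = {(x, f'(x)^t η) ; x ∈ X, (f(x), η) ∈ Γ}`. -/
def pullbackCone (f : (Fin m → F) → (Fin n → F)) (X : Set (Fin m → F))
    (Γ : Set ((Fin n → F) × (Fin n → F))) : Set ((Fin m → F) × (Fin m → F)) :=
  {z | z.1 ∈ X ∧ ∃ η, (f z.1, η) ∈ Γ ∧ z.2 = codiff f z.1 η}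

/-- `T` extends the pullback `g ↦ g ∘ f`, where `C^∞` is embedded into distributions by
`g ↦ g dx`. -/
def ExtendsPullback [ProperSpace F] [MeasurableSpace F] [BorelSpace F]
    (χ : StdChar F) (Λ : Subgroup Fˣ) {X : Set (Fin m → F)} {Y : Set (Fin n → F)}
    {Γ : Set ((Fin n → F) × (Fin n → F))} {Γ' : Set ((Fin m → F) × (Fin m → F))}
    {f : (Fin m → F) → (Fin n → F)} (hf : AnalyticOnNhd F f X) (hXY : MapsTo f X Y)
    (T : DistWF χ Λ Y Γ → DistWF χ Λ X Γ') : Prop :=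
  ∀ (g : Smooth Y) (hg : ofSmooth g ∈ DistWF χ Λ Y Γ),
    (T ⟨ofSmooth g, hg⟩).1 = ofSmooth (pullbackSmooth hf hXY g)

end Distributions

end PadicWF

/-! Write `u_r(y)` for the mean of `u` over the ball of radius `r = ‖ϖ‖ ^ k` around `y`. This is a
smooth function, and the pullback of `u` is the limit of `u_r ∘ f` as `k → ∞`. Over an ultrametric
field the usual decay estimates become exact vanishing, and the limit is reached after finitely many
steps for each test function.

Let `φ` be the indicator of a small ball near `x₀` and `ψ` that of a ball around `f x₀`. The Fourier
transform of the indicator of a ball is a multiple of the indicator of the dual ball, so Fourier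
inversion (`regPullback_mulSB_charFn`) expresses the transform of `φ · (u_r ∘ f)` at `ξ` as the
integral over `‖η‖ ≤ 1/r` of `𝓕(ψu)(η)` times the oscillatory integral of `χ(f(x)·η - x·ξ) φ(x)`.
Let `W` be a closed cone avoided by `f^*Γ` over `x₀`, and let `ξ ∈ W ∪ {0}`. The covectors `η ≠ 0`
with `f'(x₀)^t η ∈ W ∪ {0}` have a conic neighbourhood avoided by `Γ` near `f x₀`, because `Γ`
misses `N_f`; there `𝓕(ψu)(η)` vanishes for large `η`. Elsewhere `‖f'(x₀)^t η - ξ‖ ≥ c max(‖η‖,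
‖ξ‖)`, and non-stationary phase (`integral_char_eq_zero`) kills the oscillatory integral once
`max(‖η‖, ‖ξ‖)` is large. Hence the integrand vanishes for large `(η, ξ)`: this is
`exists_stationary_ballSB`.

At `ξ = 0` this gives stationarity in `k`, hence existence; for `ξ ∈ W` it bounds the Fourier
support, hence the wave front set. All bounds are uniform over families with uniformly bounded
Fourier supports (`UniformWF`), which gives sequential continuity. A single distribution is such a
family relative to its own wave front set (`uniformWF_singleton`). Uniqueness holds because `u_r →
u` in `𝓢^*_Γ(Y)`, which is the case `f = id` of the same argument (`convergesTo_reg`). -/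

namespace PadicWF

/-! ### Ultrametric norms and characters -/

section Basics

variable {F : Type*} [NontriviallyNormedField F] {m n : ℕ}

theorem norm_dotProduct_le [IsUltrametricDist F] (x ξ : Fin n → F) :
    ‖x ⬝ᵥ ξ‖ ≤ ‖x‖ * ‖ξ‖ := by
  unfold dotProduct
  refine IsUltrametricDist.norm_sum_le_of_forall_le_of_nonneg (by positivity) fun i _ => ?_
  rw [norm_mul]
  gcongr
  · exact norm_le_pi_norm x i
  · exact norm_le_pi_norm ξ i

theorem StdChar.eq_one (χ : StdChar F) {a : F} (h : ‖a‖ ≤ 1) : χ.toAddChar a = 1 := by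
  simpa using (χ.conductor 1).2 (by simp) a h

theorem exists_norm_apply_eq {θ : Fin n → F} (hθ : θ ≠ 0) : ∃ i, ‖θ i‖ = ‖θ‖ := by
  have hn : Nonempty (Fin n) := by
    by_contra hcon
    rw [not_nonempty_iff] at hcon
    exact hθ (Subsingleton.elim _ _)
  obtain ⟨i, hi⟩ := Finite.exists_max fun i => ‖θ i‖
  exact ⟨i, le_antisymm (norm_le_pi_norm θ i) ((pi_norm_le_iff_of_nonneg (norm_nonneg _)).2 hi)⟩

theorem exists_norm_mul_eq_inv {θ : Fin n → F} (hθ : θ ≠ 0) {ϖ : F} (hϖ : ϖ ≠ 0) :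
    ∃ a : F, ‖a‖ * ‖θ‖ = ‖ϖ‖⁻¹ := by
  obtain ⟨i, hi⟩ := exists_norm_apply_eq hθ
  have h1 : ‖θ‖ ≠ 0 := norm_ne_zero_iff.2 hθ
  refine ⟨ϖ⁻¹ * (θ i)⁻¹, ?_⟩
  rw [norm_mul, norm_inv, norm_inv, hi]
  field_simp

/-- A nontrivial character `h ↦ χ(h·θ)` is nontrivial on each ball of radius `> 1/‖θ‖`. -/
theorem StdChar.exists_dotProduct_ne_one (χ : StdChar F) {a : F} {θ : Fin n → F}
    (h : 1 < ‖a‖ * ‖θ‖) : ∃ v : Fin n → F, ‖v‖ ≤ ‖a‖ ∧ χ.toAddChar (v ⬝ᵥ θ) ≠ 1 := by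
  have hθ : θ ≠ 0 := by
    rintro rfl
    simp at h
    linarith
  obtain ⟨i, hi⟩ := exists_norm_apply_eq hθ
  have h1 : ¬ ‖a * θ i‖ ≤ 1 := by
    rw [norm_mul, hi]
    exact not_le.2 h
  rw [← χ.conductor] at h1
  push Not at h1
  obtain ⟨t, ht, ht'⟩ := h1
  refine ⟨Pi.single i (a * t), ?_, ?_⟩
  · rw [Pi.norm_single, norm_mul]
    exact mul_le_of_le_one_right (norm_nonneg _) ht
  · rw [single_dotProduct]
    convert ht' using 2
    ring

theorem isLocallyConstant_of_ball {V : Type*} {Φ : (Fin n → F) → V} {r : ℝ} (hr : 0 < r)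
    (h : ∀ x y, ‖y - x‖ ≤ r → Φ y = Φ x) : IsLocallyConstant Φ := by
  rw [IsLocallyConstant.iff_eventually_eq]
  intro x
  filter_upwards [Metric.closedBall_mem_nhds x hr] with y hy
  exact h x y (by simpa [dist_eq_norm] using hy)

end Basics

/-! ### Haar measure and the Fourier transform of a ball -/

section Integrals

variable {F : Type*} [NontriviallyNormedField F] [ProperSpace F] [MeasurableSpace F] [BorelSpace F]
  {m n : ℕ}

instance : (haar F n).IsAddHaarMeasure := by
  unfold haar
  infer_instance

theorem haar_closedBall_one : haar F n (Metric.closedBall 0 1) = 1 := by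
  have h := Measure.addHaarMeasure_self (K₀ := integerBox F n)
  exact h

/-- Scaling by `a` multiplies Haar measure by some constant `c`. Evaluating on the balls of radius
`1` and `‖a‖` and eliminating `c` gives the relation without computing the modulus. -/
theorem haar_closedBall_mul_inv {a : F} (ha : a ≠ 0) :
    haar F n (Metric.closedBall 0 ‖a‖) * haar F n (Metric.closedBall 0 ‖a‖⁻¹) = 1 := by
  let A : (Fin n → F) ≃L[F] (Fin n → F) := ContinuousLinearEquiv.smulLeft (Units.mk0 a ha)
  have hA : ∀ x, A x = a • x := fun x => rfl
  have hpre : ∀ s : ℝ, A ⁻¹' Metric.closedBall 0 s = Metric.closedBall 0 (‖a‖⁻¹ * s) := by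
    intro s
    ext x
    simp only [mem_preimage, hA, mem_closedBall_zero_iff, norm_smul]
    rw [le_inv_mul_iff₀ (norm_pos_iff.2 ha)]
  have hmap : ∀ s : ℝ, Measure.map A (haar F n) (Metric.closedBall 0 s)
      = haar F n (Metric.closedBall 0 (‖a‖⁻¹ * s)) := by
    intro s
    rw [Measure.map_apply A.continuous.measurable Metric.isClosed_closedBall.measurableSet, hpre]
  have hH : (Measure.map A (haar F n)).IsAddHaarMeasure := A.isAddHaarMeasure_map (haar F n)
  have hc := Measure.isAddLeftInvariant_eq_smul (Measure.map A (haar F n)) (haar F n)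
  set c := (Measure.map A (haar F n)).addHaarScalarFactor (haar F n)
  have h1 := hmap 1
  have h2 := hmap ‖a‖
  rw [hc, inv_mul_cancel₀ (norm_ne_zero_iff.2 ha), haar_closedBall_one] at h2
  rw [hc, mul_one] at h1
  rw [Measure.smul_apply, ENNReal.smul_def, smul_eq_mul] at h2
  rw [← h1, Measure.smul_apply, haar_closedBall_one, ENNReal.smul_def, smul_eq_mul, mul_one,
    mul_comm, h2]

/-- The volume of the ball of radius `r` in `Fⁿ`. -/
noncomputable def ballVol (F : Type*) [NontriviallyNormedField F] [ProperSpace F]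
    [MeasurableSpace F] [BorelSpace F] (n : ℕ) (r : ℝ) : ℂ :=
  ((haar F n).real (Metric.closedBall 0 r) : ℂ)

theorem ballVol_mul_inv {a : F} (ha : a ≠ 0) : ballVol F n ‖a‖ * ballVol F n ‖a‖⁻¹ = 1 := by
  unfold ballVol Measure.real
  rw [← Complex.ofReal_mul, ← ENNReal.toReal_mul, haar_closedBall_mul_inv ha]
  simp

/-- By translation invariance the integral equals `c` times itself. Both vanishing results, for
characters on balls and for oscillatory integrals, come from this. -/
theorem integral_eq_zero_of_translate {G : (Fin n → F) → ℂ} {v : Fin n → F} {c : ℂ} (hc : c ≠ 1)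
    (h : ∀ x, G (x + v) = c * G x) : ∫ x, G x ∂haar F n = 0 := by
  have h1 : ∫ x, G (x + v) ∂haar F n = ∫ x, G x ∂haar F n := integral_add_right_eq_self G v
  simp_rw [h] at h1
  rw [integral_const_mul] at h1
  have h2 : (c - 1) * ∫ x, G x ∂haar F n = 0 := by
    rw [sub_mul, h1]
    ring
  exact (mul_eq_zero.1 h2).resolve_left (sub_ne_zero.2 hc)

/-- The ball of radius `‖a‖⁻¹` is an additive group, on which `η ↦ χ(w·η)` is trivial exactly when
`‖w‖ ≤ ‖a‖`; a nontrivial character integrates to zero. -/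
theorem integral_indicator_char [IsUltrametricDist F] (χ : StdChar F) {a : F} (ha : a ≠ 0)
    (w : Fin n → F) :
    ∫ η, (Metric.closedBall 0 ‖a‖⁻¹).indicator (fun η => χ.toAddChar (w ⬝ᵥ η)) η ∂haar F n
      = (Metric.closedBall (0 : Fin n → F) ‖a‖).indicator (fun _ => ballVol F n ‖a‖⁻¹) w := by
  have ha' : 0 < ‖a‖ := norm_pos_iff.2 ha
  by_cases hw : ‖w‖ ≤ ‖a‖
  · rw [indicator_of_mem (by simpa using hw)]
    have h1 : (Metric.closedBall (0 : Fin n → F) ‖a‖⁻¹).indicator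
        (fun η => χ.toAddChar (w ⬝ᵥ η))
        = (Metric.closedBall (0 : Fin n → F) ‖a‖⁻¹).indicator fun _ => (1 : ℂ) := by
      refine indicator_congr fun η hη => χ.eq_one ((norm_dotProduct_le _ _).trans ?_)
      have h2 : ‖η‖ ≤ ‖a‖⁻¹ := by simpa using hη
      calc ‖w‖ * ‖η‖ ≤ ‖a‖ * ‖a‖⁻¹ := by gcongr
        _ = 1 := mul_inv_cancel₀ ha'.ne'
    rw [h1, integral_indicator_const _ Metric.isClosed_closedBall.measurableSet]
    simp [ballVol]
  · rw [indicator_of_notMem (by simpa using hw)]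
    push Not at hw
    have h1 : 1 < ‖a⁻¹‖ * ‖w‖ := by
      rw [norm_inv, lt_inv_mul_iff₀ ha']
      simpa using hw
    obtain ⟨v, hv, hv'⟩ := χ.exists_dotProduct_ne_one h1
    rw [norm_inv] at hv
    refine integral_eq_zero_of_translate hv' (v := v) fun η => ?_
    have hiff : η + v ∈ Metric.closedBall (0 : Fin n → F) ‖a‖⁻¹ ↔
        η ∈ Metric.closedBall (0 : Fin n → F) ‖a‖⁻¹ := by
      simp only [mem_closedBall_zero_iff]
      constructor
      · intro h
        have := (IsUltrametricDist.norm_add_le_max (η + v) (-v)).trans (max_le h (by rwa [norm_neg]))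
        simpa using this
      · intro h
        exact (IsUltrametricDist.norm_add_le_max η v).trans (max_le h hv)
    by_cases hη : η ∈ Metric.closedBall (0 : Fin n → F) ‖a‖⁻¹
    · rw [indicator_of_mem (hiff.2 hη), indicator_of_mem hη, dotProduct_add,
        AddChar.map_add_eq_mul, dotProduct_comm w v, mul_comm]
    · rw [indicator_of_notMem (mt hiff.1 hη), indicator_of_notMem hη, mul_zero]

/-- A compactly supported locally constant function with values in a vector space has an integral,
which is a finite combination of its values. -/
theorem exists_integral_eq {V : Type*} [AddCommGroup V] [Module ℂ V] {Φ : (Fin n → F) → V}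
    (hΦ : IsLocallyConstant Φ) {K : Set (Fin n → F)} (hK : IsCompact K)
    (h0 : ∀ x ∉ K, Φ x = 0) :
    ∃ w ∈ Submodule.span ℂ (range Φ), ∀ l : V →ₗ[ℂ] ℂ, ∫ x, l (Φ x) ∂haar F n = l w := by
  classical
  have hfin : (Φ '' K).Finite := by
    -- For the discrete topology on `V` local constancy gives continuity, so the compact set `K` has
    -- finite image.
    let _ : TopologicalSpace V := ⊥
    have : DiscreteTopology V := ⟨rfl⟩
    exact (hK.image hΦ.continuous).finite_of_discrete
  -- The value `0` is left out because its level set may have infinite measure; the other level sets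
  -- lie in `K`.
  set S : Finset V := hfin.toFinset.erase 0
  refine ⟨∑ v ∈ S, ((haar F n).real (Φ ⁻¹' {v}) : ℂ) • v, ?_, fun l => ?_⟩
  · refine Submodule.sum_mem _ fun v hv => Submodule.smul_mem _ _ (Submodule.subset_span ?_)
    have h1 : v ∈ Φ '' K := by
      simpa using (Finset.mem_erase.1 hv).2
    exact image_subset_range _ _ h1
  · have h1 : ∀ x, l (Φ x) = ∑ v ∈ S, (Φ ⁻¹' {v}).indicator (fun _ => l v) x := by
      intro x
      by_cases hx : Φ x = 0
      · rw [hx, map_zero, Finset.sum_eq_zero]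
        intro v hv
        refine indicator_of_notMem (fun hv' => (Finset.mem_erase.1 hv).1 ?_) _
        rw [mem_preimage, mem_singleton_iff] at hv'
        rw [← hv', hx]
      · have hxK : x ∈ K := by
          by_contra hxK
          exact hx (h0 x hxK)
        have hS : Φ x ∈ S := by
          refine Finset.mem_erase.2 ⟨hx, ?_⟩
          simpa using ⟨x, hxK, rfl⟩
        rw [Finset.sum_eq_single_of_mem _ hS]
        · simp
        · intro v _ hv
          exact indicator_of_notMem (fun hv' => hv (by simpa using hv'.symm)) _
    simp_rw [h1]
    have hm : ∀ v, MeasurableSet (Φ ⁻¹' {v}) := fun v => (hΦ {v}).measurableSet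
    rw [integral_finsetSum]
    · rw [map_sum]
      refine Finset.sum_congr rfl fun v _ => ?_
      rw [integral_indicator_const _ (hm v)]
      simp
    · intro v hv
      rw [integrable_indicator_iff (hm v)]
      refine integrableOn_const (ne_of_lt ?_)
      refine lt_of_le_of_lt (measure_mono fun x hx => ?_) hK.measure_lt_top
      by_contra hxK
      refine (Finset.mem_erase.1 hv).1 ?_
      rw [← h0 x hxK]
      exact (mem_singleton_iff.1 hx).symm

end Integrals
-- Test functions, their localization to balls, and Fourier inversion
section TestFunctions

variable {F : Type*} [NontriviallyNormedField F] {m n : ℕ}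

theorem SB.exists_norm_le {X : Set (Fin n → F)} (φ : SB X) :
    ∃ M, 0 < M ∧ ∀ z, φ.1 z ≠ 0 → ‖z‖ ≤ M := by
  obtain ⟨M, hM⟩ := φ.2.2.1.isCompact.isBounded.exists_norm_le
  exact ⟨max M 1, by positivity, fun z hz => (hM z (subset_tsupport _ hz)).trans (le_max_left _ _)⟩

theorem SB.mem_of_ne_zero {X : Set (Fin n → F)} (φ : SB X) {z : Fin n → F} (hz : φ.1 z ≠ 0) :
    z ∈ X :=
  φ.2.2.2 (subset_tsupport _ hz)

theorem SB.ext {X : Set (Fin n → F)} {φ ψ : SB X} (h : ∀ z, φ.1 z = ψ.1 z) : φ = ψ :=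
  Subtype.ext (funext h)

@[simp]
theorem mulSB_apply {X : Set (Fin n → F)} (g : Smooth X) (φ : SB X) (z : Fin n → F) :
    (mulSB g φ).1 z = g.1 z * φ.1 z := rfl

@[simp]
theorem charFn_apply (χ : StdChar F) (X : Set (Fin n → F)) (ξ z : Fin n → F) :
    (charFn χ X ξ).1 z = χ.toAddChar (-(z ⬝ᵥ ξ)) := rfl

@[simp]
theorem mulSB_charFn_zero (χ : StdChar F) {X : Set (Fin n → F)} (φ : SB X) :
    mulSB (charFn χ X 0) φ = φ :=
  SB.ext fun z => by simp

theorem mulSB_charFn_add (χ : StdChar F) {X : Set (Fin n → F)} (φ : SB X) (ξ η : Fin n → F) :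
    mulSB (charFn χ X (ξ + η)) φ = mulSB (charFn χ X ξ) (mulSB (charFn χ X η) φ) :=
  SB.ext fun z => by
    simp [dotProduct_add, AddChar.map_add_eq_mul]
    ring

/-- The linear form evaluating a test function at a point. -/
def evalSB {X : Set (Fin n → F)} (z : Fin n → F) : SB X →ₗ[ℂ] ℂ where
  toFun φ := φ.1 z
  map_add' _ _ := rfl
  map_smul' _ _ := rfl

theorem tsupport_eq_of_isLocallyConstant {g : (Fin n → F) → ℂ} (hg : IsLocallyConstant g) :
    tsupport g = {ξ | g ξ ≠ 0} := by
  have h : IsClopen (g ⁻¹' {0}ᶜ) := ⟨⟨by simpa using hg {0}⟩, hg _⟩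
  exact h.1.closure_eq

theorem SB.mem_tsupport {X : Set (Fin n → F)} (φ : SB X) {z : Fin n → F} :
    z ∈ tsupport φ.1 ↔ φ.1 z ≠ 0 := by
  rw [tsupport_eq_of_isLocallyConstant φ.2.1]
  rfl

/-- A Lebesgue number of the support works at points where `φ` is nonzero. If `φ` vanishes at `x`
but not at `x + v`, the same argument at `x + v` with shift `-v` gives a contradiction. -/
theorem SB.exists_uniform {X : Set (Fin n → F)} (φ : SB X) :
    ∃ s, 0 < s ∧ ∀ x v, ‖v‖ ≤ s → φ.1 (x + v) = φ.1 x := by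
  have hc : ∀ x : Fin n → F, ∃ δ, 0 < δ ∧ ∀ y, ‖y - x‖ < δ → φ.1 y = φ.1 x := by
    intro x
    obtain ⟨δ, hδ, h⟩ := Metric.eventually_nhds_iff.1
      ((IsLocallyConstant.iff_eventually_eq φ.1).1 φ.2.1 x)
    exact ⟨δ, hδ, fun y hy => h (by rwa [dist_eq_norm])⟩
  choose δ hδ h using hc
  obtain ⟨s, hs, hs'⟩ := lebesgue_number_lemma_of_metric (c := fun x => Metric.ball x (δ x))
    φ.2.2.1.isCompact (fun _ => Metric.isOpen_ball)
    (fun x _ => mem_iUnion.2 ⟨x, Metric.mem_ball_self (hδ x)⟩)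
  have key : ∀ x v, ‖v‖ < s → φ.1 x ≠ 0 → φ.1 (x + v) = φ.1 x := by
    intro x v hv hx
    obtain ⟨i, hi⟩ := hs' x (subset_tsupport _ hx)
    have h1 := hi (Metric.mem_ball_self hs)
    have h2 : x + v ∈ Metric.ball i (δ i) := hi (by simpa [dist_eq_norm] using hv)
    rw [Metric.mem_ball, dist_eq_norm] at h1 h2
    rw [h i x h1, h i _ h2]
  refine ⟨s / 2, half_pos hs, fun x v hv => ?_⟩
  have hv' : ‖v‖ < s := lt_of_le_of_lt hv (half_lt_self hs)
  by_cases hx : φ.1 x = 0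
  · by_contra hcon
    rw [hx] at hcon
    have := key (x + v) (-v) (by rwa [norm_neg]) hcon
    rw [add_neg_cancel_right, hx] at this
    exact hcon this.symm
  · exact key x v hv' hx

variable [IsUltrametricDist F]

/-- On a support of radius `M` the characters of two frequencies at distance at most `1/M` coincide.
Since the test functions themselves agree, the conclusion passes to every linear functional, with no
topology on `𝓢(X)`. -/
theorem isLocallyConstant_mulSB_charFn (χ : StdChar F) {X : Set (Fin n → F)} (φ : SB X) :
    IsLocallyConstant fun ξ => mulSB (charFn χ X ξ) φ := by
  obtain ⟨M, hM, hφ⟩ := SB.exists_norm_le φ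
  refine isLocallyConstant_of_ball (inv_pos.2 hM) fun ξ η h => SB.ext fun z => ?_
  by_cases hz : φ.1 z = 0
  · simp [hz]
  · have h1 : χ.toAddChar (-(z ⬝ᵥ (η - ξ))) = 1 := by
      refine χ.eq_one ?_
      rw [norm_neg]
      calc _ ≤ ‖z‖ * ‖η - ξ‖ := norm_dotProduct_le _ _
        _ ≤ M * M⁻¹ := by gcongr; exact hφ z hz
        _ = 1 := mul_inv_cancel₀ hM.ne'
    have h2 : -(z ⬝ᵥ η) = -(z ⬝ᵥ (η - ξ)) + -(z ⬝ᵥ ξ) := by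
      rw [dotProduct_sub]
      ring
    simp only [mulSB_apply, charFn_apply]
    rw [h2, AddChar.map_add_eq_mul, h1, one_mul]

theorem isLocallyConstant_fourierMul (χ : StdChar F) {X : Set (Fin n → F)} (φ : SB X)
    (u : Dist X) : IsLocallyConstant (fourierMul χ φ u) :=
  (isLocallyConstant_mulSB_charFn χ φ).comp u

theorem mem_tsupport_fourierMul (χ : StdChar F) {X : Set (Fin n → F)} (φ : SB X) (u : Dist X)
    {ξ : Fin n → F} : ξ ∈ tsupport (fourierMul χ φ u) ↔ fourierMul χ φ u ξ ≠ 0 := by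
  rw [tsupport_eq_of_isLocallyConstant (isLocallyConstant_fourierMul χ φ u)]
  rfl

theorem isLocallyConstant_char (χ : StdChar F) (y : Fin n → F) :
    IsLocallyConstant fun η => χ.toAddChar (y ⬝ᵥ η) := by
  refine isLocallyConstant_of_ball (r := (‖y‖ + 1)⁻¹) (by positivity) fun ξ η h => ?_
  have h1 : χ.toAddChar (y ⬝ᵥ (η - ξ)) = 1 := by
    refine χ.eq_one ?_
    calc _ ≤ ‖y‖ * ‖η - ξ‖ := norm_dotProduct_le _ _
      _ ≤ (‖y‖ + 1) * (‖y‖ + 1)⁻¹ := by gcongr; linarith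
      _ = 1 := mul_inv_cancel₀ (by positivity)
  have h2 : y ⬝ᵥ η = y ⬝ᵥ (η - ξ) + y ⬝ᵥ ξ := by
    rw [dotProduct_sub]
    ring
  rw [h2, AddChar.map_add_eq_mul, h1, one_mul]

theorem isLocallyConstant_indicator_closedBall {r : ℝ} (hr : 0 < r) (y : Fin n → F) (c : ℂ) :
    IsLocallyConstant ((Metric.closedBall y r).indicator fun _ => c) := by
  refine isLocallyConstant_of_ball hr fun x z h => ?_
  have hz : z ∈ Metric.closedBall x r := by simpa [dist_eq_norm] using h
  have h1 : z ∈ Metric.closedBall y r ↔ x ∈ Metric.closedBall y r := by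
    rw [Metric.mem_closedBall_comm, Metric.mem_closedBall_comm (x := x),
      IsUltrametricDist.closedBall_eq_of_mem hz]
  by_cases hx : x ∈ Metric.closedBall y r
  · rw [indicator_of_mem hx, indicator_of_mem (h1.2 hx)]
  · rw [indicator_of_notMem hx, indicator_of_notMem (mt h1.1 hx)]

variable [ProperSpace F]

open Classical in
/-- The indicator function of the closed ball of radius `r` around `y`, as an element of `𝓢(X)`;
it is zero when the ball is not contained in `X`. -/
noncomputable def ballSB (X : Set (Fin n → F)) (r : ℝ) (y : Fin n → F) : SB X :=
  if h : 0 < r ∧ Metric.closedBall y r ⊆ X then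
    ⟨(Metric.closedBall y r).indicator fun _ => 1, by
      have hs : tsupport ((Metric.closedBall y r).indicator fun _ => (1 : ℂ)) ⊆
          Metric.closedBall y r :=
        closure_minimal support_indicator_subset Metric.isClosed_closedBall
      exact ⟨isLocallyConstant_indicator_closedBall h.1 y 1,
        (isCompact_closedBall y r).of_isClosed_subset (isClosed_tsupport _) hs, hs.trans h.2⟩⟩
  else 0

theorem ballSB_apply {X : Set (Fin n → F)} {r : ℝ} (hr : 0 < r) {y : Fin n → F}
    (h : Metric.closedBall y r ⊆ X) (z : Fin n → F) :
    (ballSB X r y).1 z = (Metric.closedBall y r).indicator (fun _ => 1) z := by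
  unfold ballSB
  rw [dif_pos ⟨hr, h⟩]

theorem ballSB_congr {X : Set (Fin n → F)} {r : ℝ} {y z : Fin n → F} (h : ‖z - y‖ ≤ r) :
    ballSB X r z = ballSB X r y := by
  have hz : z ∈ Metric.closedBall y r := by simpa [dist_eq_norm] using h
  have h1 := IsUltrametricDist.closedBall_eq_of_mem hz
  by_cases hX : 0 < r ∧ Metric.closedBall y r ⊆ X
  · have hX' : Metric.closedBall z r ⊆ X := h1 ▸ hX.2
    refine SB.ext fun x => ?_
    rw [ballSB_apply hX.1 hX', ballSB_apply hX.1 hX.2, h1]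
  · unfold ballSB
    rw [dif_neg hX, dif_neg (by rwa [← h1])]

theorem isLocallyConstant_ballSB {X : Set (Fin n → F)} {r : ℝ} (hr : 0 < r) :
    IsLocallyConstant (ballSB X r) :=
  isLocallyConstant_of_ball hr fun _ _ h => ballSB_congr h

variable [MeasurableSpace F] [BorelSpace F]

/-- Fourier inversion for `φu`, tested against the indicator function of a ball on which `φ` is
constant. -/
theorem integral_char_mul_fourierMul (χ : StdChar F) {X : Set (Fin n → F)} {a : F} (ha : a ≠ 0)
    (u : Dist X) (φ : SB X) {c : ℂ} {y : Fin n → F} (hy : Metric.closedBall y ‖a‖ ⊆ X)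
    (hφ : ∀ z ∈ Metric.closedBall y ‖a‖, φ.1 z = c) :
    ∫ η, (Metric.closedBall 0 ‖a‖⁻¹).indicator
        (fun η => χ.toAddChar (y ⬝ᵥ η) * fourierMul χ φ u η) η ∂haar F n
      = ballVol F n ‖a‖⁻¹ * c * u (ballSB X ‖a‖ y) := by
  have ha' : 0 < ‖a‖ := norm_pos_iff.2 ha
  -- The integral is taken in `𝓢(X)`, where it is a finite combination of values, so that `u` can be
  -- pulled out of it. The resulting test function is then identified pointwise.
  let Φ : (Fin n → F) → SB X := fun η =>
    ((Metric.closedBall 0 ‖a‖⁻¹).indicator (fun _ => 1) η * χ.toAddChar (y ⬝ᵥ η)) •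
      mulSB (charFn χ X η) φ
  have hΦ : IsLocallyConstant Φ :=
    ((isLocallyConstant_indicator_closedBall (inv_pos.2 ha') 0 1).comp₂
      (isLocallyConstant_char χ y) (· * ·)).comp₂ (isLocallyConstant_mulSB_charFn χ φ) (· • ·)
  obtain ⟨w, -, hw⟩ := exists_integral_eq hΦ (isCompact_closedBall 0 ‖a‖⁻¹) fun η hη => by
    simp only [Φ]
    rw [indicator_of_notMem hη, zero_mul, zero_smul]
  have hw' : w = (ballVol F n ‖a‖⁻¹ * c) • ballSB X ‖a‖ y := by
    refine SB.ext fun z => ?_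
    have h1 := hw (evalSB z)
    have h2 : ∀ η, evalSB z (Φ η) = (Metric.closedBall 0 ‖a‖⁻¹).indicator
        (fun η => χ.toAddChar ((y - z) ⬝ᵥ η)) η * φ.1 z := by
      intro η
      change (indicator _ _ η * χ.toAddChar (y ⬝ᵥ η)) * (χ.toAddChar (-(z ⬝ᵥ η)) * φ.1 z) = _
      by_cases hη : η ∈ Metric.closedBall (0 : Fin n → F) ‖a‖⁻¹
      · rw [indicator_of_mem hη, indicator_of_mem hη, sub_dotProduct, sub_eq_add_neg,
          AddChar.map_add_eq_mul]
        ring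
      · rw [indicator_of_notMem hη, indicator_of_notMem hη]
        ring
    simp_rw [h2] at h1
    rw [integral_mul_const, integral_indicator_char χ ha] at h1
    change w.1 z = (ballVol F n ‖a‖⁻¹ * c) * (ballSB X ‖a‖ y).1 z
    change _ = w.1 z at h1
    rw [← h1, ballSB_apply ha' hy]
    by_cases hz : z ∈ Metric.closedBall y ‖a‖
    · have hz' : y - z ∈ Metric.closedBall (0 : Fin n → F) ‖a‖ := by
        rwa [mem_closedBall_zero_iff, ← dist_eq_norm, dist_comm]
      rw [indicator_of_mem hz, indicator_of_mem hz', hφ z hz, mul_one]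
    · have hz' : y - z ∉ Metric.closedBall (0 : Fin n → F) ‖a‖ := by
        rwa [mem_closedBall_zero_iff, ← dist_eq_norm, dist_comm]
      rw [indicator_of_notMem hz, indicator_of_notMem hz', zero_mul, mul_zero]
  have h3 := hw u
  rw [hw', map_smul, smul_eq_mul] at h3
  rw [← h3]
  congr 1
  ext η
  simp only [Φ, map_smul, smul_eq_mul]
  by_cases hη : η ∈ Metric.closedBall (0 : Fin n → F) ‖a‖⁻¹
  · rw [indicator_of_mem hη, indicator_of_mem hη, one_mul]
    rfl
  · rw [indicator_of_notMem hη, indicator_of_notMem hη, zero_mul, zero_mul]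

/-- Each test function is the mean of the indicator functions of the balls of radius `r` around
the points of its support, for all small `r`. -/
theorem SB.exists_mean {X : Set (Fin n → F)} (φ : SB X) :
    ∃ s > 0, ∀ r, 0 < r → r ≤ s → (∀ y, φ.1 y ≠ 0 → Metric.closedBall y r ⊆ X) ∧
      ballVol F n r • φ ∈ Submodule.span ℂ (range fun y => φ.1 y • ballSB X r y) ∧
      ∀ u : SB X →ₗ[ℂ] ℂ, ∫ y, u (ballSB X r y) * φ.1 y ∂haar F n = ballVol F n r * u φ := by
  obtain ⟨s, hs, hs'⟩ := SB.exists_uniform φ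
  refine ⟨s, hs, fun r hr hrs => ?_⟩
  have hball : ∀ y z, z ∈ Metric.closedBall y r → φ.1 z = φ.1 y := by
    intro y z hz
    have h1 := hs' y (z - y) (by
      rw [← dist_eq_norm]
      exact hz.trans hrs)
    rwa [add_sub_cancel] at h1
  have hmem : ∀ y, φ.1 y ≠ 0 → Metric.closedBall y r ⊆ X := by
    intro y hy z hz
    refine SB.mem_of_ne_zero φ ?_
    rwa [hball y z hz]
  obtain ⟨w, hws, hw⟩ := exists_integral_eq
    (Φ := fun y => φ.1 y • ballSB X r y)
    (φ.2.1.comp₂ (isLocallyConstant_ballSB hr) (· • ·)) φ.2.2.1.isCompact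
    (fun x hx => by
      rw [image_eq_zero_of_notMem_tsupport hx, zero_smul])
  have hw' : w = ballVol F n r • φ := by
    refine SB.ext fun z => ?_
    have h1 := hw (evalSB z)
    have h2 : ∀ y, evalSB z (φ.1 y • ballSB X r y) =
        (Metric.closedBall z r).indicator (fun _ => φ.1 z) y := by
      intro y
      change φ.1 y * (ballSB X r y).1 z = _
      by_cases hy : y ∈ Metric.closedBall z r
      · rw [indicator_of_mem hy, hball z y hy]
        by_cases hz : φ.1 z = 0
        · simp [hz]
        · rw [ballSB_apply hr (hmem y (by rwa [hball z y hy])),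
            indicator_of_mem (Metric.mem_closedBall_comm.1 hy), mul_one]
      · rw [indicator_of_notMem hy]
        by_cases hz : φ.1 y = 0
        · simp [hz]
        · rw [ballSB_apply hr (hmem y hz),
            indicator_of_notMem (mt Metric.mem_closedBall_comm.1 hy), mul_zero]
    simp_rw [h2] at h1
    rw [integral_indicator_const _ Metric.isClosed_closedBall.measurableSet] at h1
    change _ = w.1 z at h1
    rw [← h1]
    change _ = ballVol F n r * φ.1 z
    rw [ballVol, Measure.addHaar_real_closedBall_center]
    simp
  refine ⟨hmem, hw' ▸ hws, fun u => ?_⟩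
  rw [← smul_eq_mul, ← map_smul, ← hw', ← hw u]
  congr 1
  ext y
  rw [map_smul, smul_eq_mul, mul_comm]

omit [IsUltrametricDist F] in
theorem ballVol_pow_ne_zero {ϖ : F} (hϖ0 : ϖ ≠ 0) (k : ℕ) : ballVol F n (‖ϖ‖ ^ k) ≠ 0 := by
  rw [← norm_pow]
  exact left_ne_zero_of_mul_eq_one (ballVol_mul_inv (pow_ne_zero k hϖ0))

/-- A property of test functions that is stable under linear combinations holds as soon as it holds
locally for indicator functions of small balls. -/
theorem SB.ball_induction {X : Set (Fin n → F)} {ϖ : F} (hϖ0 : ϖ ≠ 0) (hϖ1 : ‖ϖ‖ < 1) (φ : SB X)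
    (P : SB X → Prop) (zero : P 0) (add : ∀ a b, P a → P b → P (a + b))
    (smul : ∀ (c : ℂ) a, P a → P (c • a))
    (ball : ∀ x ∈ tsupport φ.1, ∃ δ > 0, ∀ (k : ℕ) (y : Fin n → F),
      Metric.closedBall y (‖ϖ‖ ^ k) ⊆ Metric.ball x δ → Metric.closedBall y (‖ϖ‖ ^ k) ⊆ X →
        P (ballSB X (‖ϖ‖ ^ k) y)) :
    P φ := by
  choose! δ hδ hP using ball
  obtain ⟨s, hs, hs'⟩ := lebesgue_number_lemma_of_metric
    (c := fun x : tsupport φ.1 => Metric.ball x.1 (δ x.1))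
    φ.2.2.1.isCompact (fun _ => Metric.isOpen_ball)
    (fun x hx => mem_iUnion.2 ⟨⟨x, hx⟩, Metric.mem_ball_self (hδ x hx)⟩)
  obtain ⟨t, ht, ht'⟩ := SB.exists_mean φ
  -- The radius is below `s`, so each ball lies in one set of the cover, and below `t`, so `φ` is a
  -- combination of indicators of such balls.
  obtain ⟨k, hk⟩ := exists_pow_lt_of_lt_one (lt_min hs ht) hϖ1
  obtain ⟨hmem, hspan, -⟩ := ht' (‖ϖ‖ ^ k) (by positivity) (hk.le.trans (min_le_right _ _))
  have hφ : φ = (ballVol F n (‖ϖ‖ ^ k))⁻¹ • ballVol F n (‖ϖ‖ ^ k) • φ := by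
    rw [smul_smul, inv_mul_cancel₀ (ballVol_pow_ne_zero hϖ0 k), one_smul]
  rw [hφ]
  refine smul _ _ ?_
  refine Submodule.span_induction ?_ zero (fun a b _ _ => add a b) (fun c a _ => smul c a) hspan
  rintro _ ⟨y, rfl⟩
  by_cases hy : φ.1 y = 0
  · simp only [hy, zero_smul]
    exact zero
  · refine smul _ _ ?_
    obtain ⟨i, hi⟩ := hs' y (subset_tsupport _ hy)
    refine hP i.1 i.2 k y (Subset.trans ?_ hi) (hmem y hy)
    exact Metric.closedBall_subset_ball (hk.trans_le (min_le_left _ _))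

end TestFunctions
-- Non-stationary phase
section Oscillatory

section

variable {F : Type*} [NontriviallyNormedField F] {n : ℕ}

theorem StdChar.continuous (χ : StdChar F) : Continuous χ.toAddChar := by
  refine IsLocallyConstant.continuous ?_
  rw [IsLocallyConstant.iff_eventually_eq]
  intro x
  filter_upwards [Metric.closedBall_mem_nhds x one_pos] with y hy
  have h1 : χ.toAddChar (y - x) = 1 := χ.eq_one (by simpa [dist_eq_norm] using hy)
  rw [← sub_add_cancel y x, AddChar.map_add_eq_mul, h1, one_mul]

theorem ofSmooth_apply [ProperSpace F] [MeasurableSpace F] [BorelSpace F]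
    {X : Set (Fin n → F)} (g : Smooth X) (φ : SB X) :
    ofSmooth g φ = ∫ x, g.1 x * φ.1 x ∂haar F n := rfl

end

variable {F : Type*} [NontriviallyNormedField F] [IsUltrametricDist F] [ProperSpace F]
  [MeasurableSpace F] [BorelSpace F] {m n : ℕ}

/-- Non-stationary phase: the phase `f(x)·η - x·ξ` has gradient `θ` up to an error controlled
by `ε`, and `φ` is constant on balls of radius `s`. -/
theorem integral_char_eq_zero (χ : StdChar F) {ϖ : F} (hϖ0 : ϖ ≠ 0) (hϖ1 : ‖ϖ‖ < 1)
    {f L : (Fin m → F) → (Fin n → F)} {φ : (Fin m → F) → ℂ} {η : Fin n → F} {ξ θ : Fin m → F}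
    {ε s : ℝ} (hε : 0 ≤ ε)
    (hf : ∀ x v, φ x ≠ 0 → φ (x + v) ≠ 0 → ‖f (x + v) - f x - L v‖ ≤ ε * ‖v‖)
    (hL : ∀ v, v ⬝ᵥ θ = L v ⬝ᵥ η - v ⬝ᵥ ξ)
    (hφ : ∀ x v, ‖v‖ ≤ s → φ (x + v) = φ x)
    (h1 : 1 ≤ s * ‖ϖ‖ * ‖θ‖) (h2 : ε * ‖η‖ ≤ ‖ϖ‖ * ‖θ‖) :
    ∫ x, χ.toAddChar (f x ⬝ᵥ η - x ⬝ᵥ ξ) * φ x ∂haar F m = 0 := by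
  have hϖ : 0 < ‖ϖ‖ := norm_pos_iff.2 hϖ0
  have hθ : θ ≠ 0 := by
    rintro rfl
    simp at h1
    linarith
  have hθ' : 0 < ‖θ‖ := norm_pos_iff.2 hθ
  -- The choice `‖a‖ = 1/(‖ϖ‖‖θ‖)` leaves room for a shift `v` with `χ(v·θ) ≠ 1`. By `h1` such a
  -- shift preserves `φ`, and by `h2` the error of linearization pairs with `η` into `𝔬`, where `χ`
  -- is trivial.
  obtain ⟨a, ha⟩ := exists_norm_mul_eq_inv hθ hϖ0
  obtain ⟨v, hv, hv'⟩ := χ.exists_dotProduct_ne_one (a := a) (θ := θ) (by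
    rw [ha]
    exact (one_lt_inv₀ hϖ).2 hϖ1)
  have ha' : ‖a‖ * (‖ϖ‖ * ‖θ‖) = 1 := by
    rw [mul_left_comm, ha, mul_inv_cancel₀ hϖ.ne']
  have hvs : ‖v‖ ≤ s := by
    refine hv.trans ?_
    calc ‖a‖ ≤ ‖a‖ * (s * ‖ϖ‖ * ‖θ‖) := le_mul_of_one_le_right (norm_nonneg _) h1
      _ = s * (‖a‖ * (‖ϖ‖ * ‖θ‖)) := by ring
      _ = s := by rw [ha', mul_one]
  refine integral_eq_zero_of_translate hv' (v := v) fun x => ?_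
  rw [hφ x v hvs]
  by_cases hx : φ x = 0
  · simp [hx]
  have hxv : φ (x + v) ≠ 0 := by rwa [hφ x v hvs]
  have h3 : χ.toAddChar ((f (x + v) - f x - L v) ⬝ᵥ η) = 1 := by
    refine χ.eq_one ((norm_dotProduct_le _ _).trans ?_)
    calc _ ≤ ε * ‖v‖ * ‖η‖ := by gcongr; exact hf x v hx hxv
      _ ≤ ε * ‖a‖ * ‖η‖ := by gcongr
      _ = ‖a‖ * (ε * ‖η‖) := by ring
      _ ≤ ‖a‖ * (‖ϖ‖ * ‖θ‖) := by gcongr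
      _ = 1 := ha'
  have h4 : f (x + v) ⬝ᵥ η - (x + v) ⬝ᵥ ξ =
      (f (x + v) - f x - L v) ⬝ᵥ η + v ⬝ᵥ θ + (f x ⬝ᵥ η - x ⬝ᵥ ξ) := by
    rw [hL, sub_dotProduct, sub_dotProduct, add_dotProduct]
    ring
  rw [h4, AddChar.map_add_eq_mul, AddChar.map_add_eq_mul, h3]
  ring

/-- The Fourier transform of a test function has bounded support. -/
theorem SB.exists_fourier_eq_zero (χ : StdChar F) {ϖ : F} (hϖ0 : ϖ ≠ 0) (hϖ1 : ‖ϖ‖ < 1)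
    {X : Set (Fin n → F)} (φ : SB X) :
    ∃ R, ∀ ξ : Fin n → F, R < ‖ξ‖ →
      ∫ x, χ.toAddChar (-(x ⬝ᵥ ξ)) * φ.1 x ∂haar F n = 0 := by
  obtain ⟨s, hs, hφ⟩ := SB.exists_uniform φ
  have hϖ : 0 < ‖ϖ‖ := norm_pos_iff.2 hϖ0
  refine ⟨(s * ‖ϖ‖)⁻¹, fun ξ hξ => ?_⟩
  have h := integral_char_eq_zero (m := n) (n := n) χ hϖ0 hϖ1 (f := 0) (L := 0) (η := 0) (ξ := ξ)
    (θ := -ξ) (φ := φ.1) (ε := 0) le_rfl (by simp) (by simp) hφ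
    (by
      rw [norm_neg]
      have := (inv_lt_iff_one_lt_mul₀' (by positivity)).1 hξ
      exact this.le)
    (by
      rw [zero_mul]
      positivity)
  simpa using h

/-- `φ ↦ 𝓕(φ g)` has bounded support for smooth `g`. -/
theorem exists_fourierMul_ofSmooth_eq_zero (χ : StdChar F) {ϖ : F} (hϖ0 : ϖ ≠ 0) (hϖ1 : ‖ϖ‖ < 1)
    {X : Set (Fin n → F)} (g : Smooth X) (φ : SB X) :
    ∃ R, ∀ ξ : Fin n → F, R < ‖ξ‖ → fourierMul χ φ (ofSmooth g) ξ = 0 := by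
  obtain ⟨R, hR⟩ := SB.exists_fourier_eq_zero χ hϖ0 hϖ1 (mulSB g φ)
  refine ⟨R, fun ξ hξ => ?_⟩
  rw [← hR ξ hξ]
  change ∫ x, g.1 x * (χ.toAddChar (-(x ⬝ᵥ ξ)) * φ.1 x) ∂haar F n = _
  congr 1
  ext x
  simp only [mulSB_apply]
  ring

end Oscillatory

/-! ### Regularization by means over balls -/

section Regularization

variable {F : Type*} [NontriviallyNormedField F] [IsUltrametricDist F] [ProperSpace F]
  [MeasurableSpace F] [BorelSpace F] {m n : ℕ}

/-- The regularization of a distribution: its mean values over balls of radius `r`. -/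
noncomputable def reg {Y : Set (Fin n → F)} (r : ℝ) (u : Dist Y) : Smooth Y :=
  ⟨fun y => (ballVol F n r)⁻¹ * u (ballSB Y r y), by
    intro x _
    by_cases hr : 0 < r
    · filter_upwards [(IsLocallyConstant.iff_eventually_eq _).1
        (isLocallyConstant_ballSB (X := Y) hr) x] with y hy
      rw [hy]
    · refine Eventually.of_forall fun y => ?_
      simp [ballSB, hr]⟩

/-- The pullback of the regularization of a distribution. -/
noncomputable def regPullback {X : Set (Fin m → F)} {Y : Set (Fin n → F)}
    {f : (Fin m → F) → (Fin n → F)} (hf : AnalyticOnNhd F f X) (hXY : MapsTo f X Y) (r : ℝ)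
    (u : Dist Y) : Dist X :=
  ofSmooth (pullbackSmooth hf hXY (reg r u))

variable {X : Set (Fin m → F)} {Y : Set (Fin n → F)}
    {f : (Fin m → F) → (Fin n → F)} (hf : AnalyticOnNhd F f X) (hXY : MapsTo f X Y)

theorem regPullback_apply (r : ℝ) (u : Dist Y) (φ : SB X) :
    regPullback hf hXY r u φ =
      ∫ x, (ballVol F n r)⁻¹ * u (ballSB Y r (f x)) * φ.1 x ∂haar F m := rfl

/-- `regPullback` is the transpose of a map of test functions. -/
theorem exists_regPullback_eq {r : ℝ} (hr : 0 < r) (φ : SB X) :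
    ∃ w : SB Y, ∀ u : Dist Y, regPullback hf hXY r u φ = u w := by
  have hloc : IsLocallyConstant fun x => φ.1 x • ballSB Y r (f x) := by
    rw [IsLocallyConstant.iff_eventually_eq]
    intro x
    have hφ := (IsLocallyConstant.iff_eventually_eq _).1 φ.2.1 x
    by_cases hx : φ.1 x = 0
    · filter_upwards [hφ] with y hy
      simp [hy, hx]
    · have hc := (hf x (SB.mem_of_ne_zero φ hx)).continuousAt
      filter_upwards [hφ, hc.eventually ((IsLocallyConstant.iff_eventually_eq _).1
        (isLocallyConstant_ballSB (X := Y) hr) (f x))] with y hy hy'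
      rw [hy, hy']
  obtain ⟨w, -, hw⟩ := exists_integral_eq hloc φ.2.2.1.isCompact (fun x hx => by
    rw [image_eq_zero_of_notMem_tsupport hx, zero_smul])
  refine ⟨(ballVol F n r)⁻¹ • w, fun u => ?_⟩
  rw [map_smul, ← hw u, smul_eq_mul, ← integral_const_mul, regPullback_apply]
  congr 1
  ext x
  rw [map_smul, smul_eq_mul]
  ring

/-- The regularized pullback as an integral over the frequencies `‖η‖ ≤ 1/r`. -/
theorem regPullback_mulSB_charFn (χ : StdChar F) {a : F} (ha : a ≠ 0) (u : Dist Y) (φ : SB X)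
    {y₀ : Fin n → F} {ρ : ℝ} (hρ : Metric.closedBall y₀ ρ ⊆ Y) (haρ : ‖a‖ ≤ ρ)
    (hφ : ∀ x, φ.1 x ≠ 0 → f x ∈ Metric.closedBall y₀ ρ) (ξ : Fin m → F) :
    regPullback hf hXY ‖a‖ u (mulSB (charFn χ X ξ) φ) =
      ∫ η, (Metric.closedBall 0 ‖a‖⁻¹).indicator (fun η => fourierMul χ (ballSB Y ρ y₀) u η *
        ∫ x, χ.toAddChar (f x ⬝ᵥ η - x ⬝ᵥ ξ) * φ.1 x ∂haar F m) η ∂haar F n := by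
  have ha' : 0 < ‖a‖ := norm_pos_iff.2 ha
  set ψ := ballSB Y ρ y₀
  let G : (Fin n → F) → ℂ := (Metric.closedBall 0 ‖a‖⁻¹).indicator fun η => fourierMul χ ψ u η
  have hG : Continuous G := by
    refine Continuous.indicator (fun η hη => ?_) (isLocallyConstant_fourierMul χ ψ u).continuous
    rw [(IsUltrametricDist.isClopen_closedBall _ (inv_pos.2 ha').ne').frontier_eq] at hη
    exact hη.elim
  let K : (Fin m → F) → (Fin n → F) → ℂ := fun x η =>
    G η * (χ.toAddChar (f x ⬝ᵥ η - x ⬝ᵥ ξ) * φ.1 x)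
  have hinner : ∀ x, (ballVol F n ‖a‖)⁻¹ * u (ballSB Y ‖a‖ (f x)) *
      (mulSB (charFn χ X ξ) φ).1 x = ∫ η, K x η ∂haar F n := by
    intro x
    by_cases hx : φ.1 x = 0
    · simp [K, hx]
    -- Any point of an ultrametric ball is a center, so the small ball around `f x` stays where `ψ =
    -- 1`, and Fourier inversion applies with `c = 1`.
    have hball : Metric.closedBall (f x) ‖a‖ ⊆ Metric.closedBall y₀ ρ := by
      rw [IsUltrametricDist.closedBall_eq_of_mem (hφ x hx)]
      exact Metric.closedBall_subset_closedBall haρ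
    have h1 := integral_char_mul_fourierMul χ ha u ψ (c := 1) (hball.trans hρ) fun z hz => by
      rw [ballSB_apply (ha'.trans_le haρ) hρ, indicator_of_mem (hball hz)]
    have h2 : (ballVol F n ‖a‖)⁻¹ = ballVol F n ‖a‖⁻¹ :=
      (eq_inv_of_mul_eq_one_right (ballVol_mul_inv ha)).symm
    rw [mul_one] at h1
    rw [h2, ← h1, ← integral_mul_const]
    congr 1
    ext η
    simp only [K, G, mulSB_apply, charFn_apply]
    by_cases hη : η ∈ Metric.closedBall (0 : Fin n → F) ‖a‖⁻¹
    · rw [indicator_of_mem hη, indicator_of_mem hη, sub_eq_add_neg, AddChar.map_add_eq_mul]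
      ring
    · rw [indicator_of_notMem hη, indicator_of_notMem hη, zero_mul, zero_mul]
  rw [regPullback_apply]
  simp_rw [hinner]
  rw [integral_integral_swap_of_hasCompactSupport]
  · congr 1
    ext η
    simp only [K, G]
    rw [integral_const_mul]
    by_cases hη : η ∈ Metric.closedBall (0 : Fin n → F) ‖a‖⁻¹
    · rw [indicator_of_mem hη, indicator_of_mem hη]
    · rw [indicator_of_notMem hη, indicator_of_notMem hη, zero_mul]
  -- Continuity of `f` is known on `X` only; near a zero of `φ` the integrand vanishes identically
  -- because `φ` is locally constant.
  · rw [continuous_iff_continuousAt]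
    rintro ⟨x, η⟩
    by_cases hx : φ.1 x = 0
    · have hev : ∀ᶠ p : (Fin m → F) × (Fin n → F) in 𝓝 (x, η), φ.1 p.1 = 0 :=
        (continuous_fst.tendsto (x, η)).eventually
          (((IsLocallyConstant.iff_eventually_eq φ.1).1 φ.2.1 x).mono fun y hy => hy.trans hx)
      refine (continuousAt_const (y := (0 : ℂ))).congr ?_
      filter_upwards [hev] with p hp
      simp [Function.uncurry, K, hp]
    · have hc : ContinuousAt (fun p : (Fin m → F) × (Fin n → F) => f p.1) (x, η) :=
        ContinuousAt.comp (f := Prod.fst) (hf x (SB.mem_of_ne_zero φ hx)).continuousAt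
          continuousAt_fst
      have hd : ContinuousAt (fun p : (Fin m → F) × (Fin n → F) =>
          f p.1 ⬝ᵥ p.2 - p.1 ⬝ᵥ ξ) (x, η) := by
        unfold dotProduct
        refine ContinuousAt.sub ?_ (by fun_prop)
        refine tendsto_finsetSum _ fun i _ => ?_
        exact ((continuousAt_apply i _).comp hc).mul
          ((continuous_apply i).comp continuous_snd).continuousAt
      have hφ' : ContinuousAt (fun p : (Fin m → F) × (Fin n → F) => φ.1 p.1) (x, η) :=
        (φ.2.1.continuous.comp continuous_fst).continuousAt
      exact (hG.comp continuous_snd).continuousAt.mul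
        ((χ.continuous.continuousAt.comp hd).mul hφ')
  · refine HasCompactSupport.intro
      (φ.2.2.1.isCompact.prod (isCompact_closedBall (0 : Fin n → F) ‖a‖⁻¹)) ?_
    rintro ⟨x, η⟩ hp
    rw [mem_prod, not_and_or] at hp
    rcases hp with hp | hp
    · simp [Function.uncurry, K, image_eq_zero_of_notMem_tsupport hp]
    · simp only [Function.uncurry, K, G]
      rw [indicator_of_notMem hp, zero_mul]

end Regularization
-- Conic neighbourhoods and compactness of directions
section Cones

theorem norm_eq_of_norm_sub_lt {E : Type*} [SeminormedAddCommGroup E] [IsUltrametricDist E]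
    {a b : E} (h : ‖a - b‖ < ‖a‖) : ‖b‖ = ‖a‖ := by
  have h1 : ‖a‖ ≤ max ‖a - b‖ ‖b‖ := by
    simpa using IsUltrametricDist.norm_add_le_max (a - b) b
  have h2 : ‖b‖ ≤ max ‖a - b‖ ‖a‖ := by
    have := IsUltrametricDist.norm_add_le_max (b - a) a
    rwa [sub_add_cancel, norm_sub_rev] at this
  rw [max_eq_right h.le] at h2
  rcases le_max_iff.1 h1 with h3 | h3
  · exact absurd h3 (not_le.2 h)
  · exact le_antisymm h2 h3

variable {F : Type*} [NontriviallyNormedField F] {m n : ℕ} {Λ : Subgroup Fˣ} {ϖ : Fˣ}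

theorem exists_smul_mem_annulus (hϖ : ‖(ϖ : F)‖ < 1) (hϖΛ : ϖ ∈ Λ) {E : Type*}
    [NormedAddCommGroup E] [NormedSpace F E] {v : E} (hv : v ≠ 0) :
    ∃ l ∈ Λ, ‖(ϖ : F)‖ ≤ ‖(l : F) • v‖ ∧ ‖(l : F) • v‖ ≤ 1 := by
  have h1 : 1 < ‖((ϖ⁻¹ : Fˣ) : F)‖ := by
    rw [Units.val_inv_eq_inv_val, norm_inv]
    exact (one_lt_inv₀ (norm_pos_iff.2 ϖ.ne_zero)).2 hϖ
  obtain ⟨k, -, h2, h3, -⟩ := rescale_to_shell_semi_normed_zpow h1 one_pos (norm_ne_zero_iff.2 hv)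
  refine ⟨ϖ⁻¹ ^ k, Λ.zpow_mem (Λ.inv_mem hϖΛ) k, ?_, ?_⟩
  · refine le_trans (le_of_eq ?_) (h3.trans (le_of_eq (by simp)))
    simp
  · refine le_trans (le_of_eq ?_) h2.le
    simp

theorem isCompact_annulus {E : Type*} [NormedAddCommGroup E] [ProperSpace E] (r : ℝ) :
    IsCompact {v : E | r ≤ ‖v‖ ∧ ‖v‖ ≤ 1} := by
  refine (isCompact_closedBall (0 : E) 1).of_isClosed_subset ?_ fun v hv => by simpa using hv.2
  exact (isClosed_le continuous_const continuous_norm).inter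
    (isClosed_le continuous_norm continuous_const)

/-- A positive homogeneous function on a closed cone is bounded below by a multiple of the norm. -/
theorem exists_mul_norm_le (hϖ : ‖(ϖ : F)‖ < 1) (hϖΛ : ϖ ∈ Λ) {E : Type*}
    [NormedAddCommGroup E] [NormedSpace F E] [ProperSpace E] {C : Set E} (hC : IsClosed C)
    (hCΛ : ∀ l ∈ Λ, ∀ v ∈ C, (l : F) • v ∈ C) {g : E → ℝ} (hg : Continuous g)
    (hgΛ : ∀ (l : Fˣ) (v : E), g ((l : F) • v) = ‖(l : F)‖ * g v)
    (hpos : ∀ v ∈ C, v ≠ 0 → 0 < g v) (hnn : ∀ v, 0 ≤ g v) :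
    ∃ c, 0 < c ∧ c ≤ 1 ∧ ∀ v ∈ C, c * ‖v‖ ≤ g v := by
  have hϖ0 : 0 < ‖(ϖ : F)‖ := norm_pos_iff.2 ϖ.ne_zero
  -- The annulus `‖ϖ‖ ≤ ‖v‖ ≤ 1` is compact and meets every `Λ`-orbit of nonzero vectors, since `ϖ ∈
  -- Λ`.
  obtain ⟨c, hc, hcg⟩ : ∃ c, 0 < c ∧ ∀ v ∈ C, ‖(ϖ : F)‖ ≤ ‖v‖ → ‖v‖ ≤ 1 → c ≤ g v := by
    have hK := (isCompact_annulus (E := E) ‖(ϖ : F)‖).inter_left hC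
    rcases (C ∩ {v : E | ‖(ϖ : F)‖ ≤ ‖v‖ ∧ ‖v‖ ≤ 1}).eq_empty_or_nonempty with he | hne
    · refine ⟨1, one_pos, fun v hv h1 h2 => ?_⟩
      have : v ∈ C ∩ {v : E | ‖(ϖ : F)‖ ≤ ‖v‖ ∧ ‖v‖ ≤ 1} := ⟨hv, h1, h2⟩
      rw [he] at this
      exact this.elim
    · obtain ⟨v, hv, hmin⟩ := hK.exists_isMinOn hne hg.continuousOn
      refine ⟨g v, hpos v hv.1 ?_, fun w hw h1 h2 => hmin ⟨hw, h1, h2⟩⟩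
      rintro rfl
      have := hv.2.1
      rw [norm_zero] at this
      linarith
  refine ⟨min c 1, lt_min hc one_pos, min_le_right _ _, fun v hv => ?_⟩
  by_cases hv0 : v = 0
  · rw [hv0, norm_zero, mul_zero]
    exact hnn 0
  obtain ⟨l, hl, h1, h2⟩ := exists_smul_mem_annulus hϖ hϖΛ hv0
  have h3 := hcg _ (hCΛ l hl v hv) h1 h2
  have hl0 : 0 < ‖(l : F)‖ := norm_pos_iff.2 l.ne_zero
  rw [hgΛ] at h3
  rw [norm_smul] at h2
  refine le_of_mul_le_mul_left ?_ hl0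
  calc ‖(l : F)‖ * (min c 1 * ‖v‖) = min c 1 * (‖(l : F)‖ * ‖v‖) := by ring
    _ ≤ c * 1 := by gcongr; exact min_le_left _ _
    _ ≤ _ := by linarith

/-- The conic neighbourhood of aperture `ε` of a cone. -/
def thick (E : Set (Fin n → F)) (ε : ℝ) : Set (Fin n → F) :=
  {η | ∃ ζ ∈ E, ‖η - ζ‖ < ε * ‖η‖}

theorem subset_thick {E : Set (Fin n → F)} {ε : ℝ} (hε : 0 < ε) (hE : IsCone Λ E) :
    E ⊆ thick E ε := fun η hη =>
  ⟨η, hη, by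
    rw [sub_self, norm_zero]
    exact mul_pos hε (norm_pos_iff.2 (hE.1 η hη))⟩

theorem isCone_thick {E : Set (Fin n → F)} {ε : ℝ} (hE : IsCone Λ E) : IsCone Λ (thick E ε) := by
  refine ⟨?_, ?_⟩
  · rintro η ⟨ζ, -, h⟩ rfl
    rw [norm_zero, mul_zero] at h
    exact absurd h (not_lt.2 (norm_nonneg _))
  · rintro l hl η ⟨ζ, hζ, h⟩
    refine ⟨(l : F) • ζ, hE.2 l hl ζ hζ, ?_⟩
    rw [← smul_sub, norm_smul, norm_smul, mul_left_comm]
    exact mul_lt_mul_of_pos_left h (norm_pos_iff.2 l.ne_zero)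

variable [IsUltrametricDist F]

/-- By the ultrametric inequality a perturbation of relative size below `ε` preserves both the norm
and the aperture. Hence these neighbourhoods are open and also closed away from the origin. -/
theorem add_mem_thick {E : Set (Fin n → F)} {ε : ℝ} (hε1 : ε ≤ 1) {η v : Fin n → F}
    (hη : η ∈ thick E ε) (hv : ‖v‖ < ε * ‖η‖) : η + v ∈ thick E ε := by
  obtain ⟨ζ, hζ, h⟩ := hη
  have h1 : ‖η + v‖ = ‖η‖ := by
    refine norm_eq_of_norm_sub_lt ?_
    rw [sub_add_cancel_left, norm_neg]
    exact hv.trans_le (mul_le_of_le_one_left (norm_nonneg _) hε1)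
  refine ⟨ζ, hζ, ?_⟩
  rw [h1, add_sub_right_comm]
  exact (IsUltrametricDist.norm_add_le_max _ _).trans_lt (max_lt h hv)

theorem isOpen_thick {E : Set (Fin n → F)} {ε : ℝ} (hε0 : 0 < ε) (hε1 : ε ≤ 1)
    (hE : IsCone Λ E) : IsOpen (thick E ε) := by
  rw [Metric.isOpen_iff]
  intro η hη
  have hpos : 0 < ‖η‖ := norm_pos_iff.2 ((isCone_thick hE).1 η hη)
  refine ⟨ε * ‖η‖, by positivity, fun z hz => ?_⟩
  rw [Metric.mem_ball, dist_eq_norm] at hz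
  rw [← add_sub_cancel η z]
  exact add_mem_thick hε1 hη hz

theorem isClosedCone_thick {E : Set (Fin n → F)} {ε : ℝ} (hε0 : 0 < ε) (hε1 : ε ≤ 1)
    (hE : IsCone Λ E) : IsClosedCone Λ (thick E ε) := by
  refine ⟨isCone_thick hE, fun η hη hη0 => ?_⟩
  have hpos : 0 < ‖η‖ := norm_pos_iff.2 hη0
  obtain ⟨z, hz, hz'⟩ := Metric.mem_closure_iff.1 hη (ε * ‖η‖) (by positivity)
  rw [dist_eq_norm] at hz'
  have h1 : ‖z‖ = ‖η‖ :=
    norm_eq_of_norm_sub_lt (hz'.trans_le (mul_le_of_le_one_left (norm_nonneg _) hε1))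
  rw [← add_sub_cancel z η]
  exact add_mem_thick hε1 hz (by rwa [h1])

/-- The cone generated by a vector. -/
def orbit (Λ : Subgroup Fˣ) (ξ : Fin n → F) : Set (Fin n → F) :=
  {η | ∃ l ∈ Λ, η = (l : F) • ξ}

omit [IsUltrametricDist F] in
theorem isCone_orbit {ξ : Fin n → F} (hξ : ξ ≠ 0) : IsCone Λ (orbit Λ ξ) := by
  refine ⟨?_, ?_⟩
  · rintro _ ⟨l, -, rfl⟩
    exact smul_ne_zero l.ne_zero hξ
  · rintro l hl _ ⟨k, hk, rfl⟩
    refine ⟨l * k, Λ.mul_mem hl hk, ?_⟩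
    rw [smul_smul, Units.val_mul]

omit [IsUltrametricDist F] in
theorem mem_orbit_self (ξ : Fin n → F) : ξ ∈ orbit Λ ξ := ⟨1, Λ.one_mem, by simp⟩

theorem smul_mem_ball_of_mem_thick_orbit {ξ η : Fin n → F} {ε : ℝ} (hε1 : ε ≤ 1)
    (hη : η ∈ thick (orbit Λ ξ) ε) :
    ∃ l ∈ Λ, (l : F) • η ∈ Metric.ball ξ (ε * ‖ξ‖) := by
  obtain ⟨_, ⟨l, hl, rfl⟩, h⟩ := hη
  refine ⟨l⁻¹, Λ.inv_mem hl, ?_⟩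
  have h1 : ‖(l : F) • ξ‖ = ‖η‖ :=
    norm_eq_of_norm_sub_lt (h.trans_le (mul_le_of_le_one_left (norm_nonneg _) hε1))
  have hl0 : 0 < ‖(l : F)‖ := norm_pos_iff.2 l.ne_zero
  rw [Metric.mem_ball, dist_eq_norm]
  refine lt_of_mul_lt_mul_left ?_ hl0.le
  rw [← norm_smul, smul_sub, smul_smul]
  simp only [Units.val_inv_eq_inv_val, ne_eq, Units.ne_zero, not_false_eq_true, mul_inv_cancel₀,
    one_smul]
  rw [mul_left_comm, ← norm_smul, h1]
  exact h

/-- Each open set containing a nonzero vector contains, up to scaling, a conic neighbourhood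
of it. -/
theorem exists_thick_orbit {V : Set (Fin n → F)} (hV : IsOpen V) {ξ : Fin n → F} (hξV : ξ ∈ V)
    (hξ : ξ ≠ 0) :
    ∃ ε, 0 < ε ∧ ε ≤ 1 ∧ ∀ η ∈ thick (orbit Λ ξ) ε, ∃ l ∈ Λ, (l : F) • η ∈ V := by
  obtain ⟨r, hr, hrV⟩ := Metric.isOpen_iff.1 hV ξ hξV
  have hpos : 0 < ‖ξ‖ := norm_pos_iff.2 hξ
  refine ⟨min (r / ‖ξ‖) 1, by positivity, min_le_right _ _, fun η hη => ?_⟩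
  obtain ⟨l, hl, h⟩ := smul_mem_ball_of_mem_thick_orbit (min_le_right _ _) hη
  refine ⟨l, hl, hrV (Metric.ball_subset_ball ?_ h)⟩
  calc _ ≤ r / ‖ξ‖ * ‖ξ‖ := by gcongr; exact min_le_left _ _
    _ = r := by field_simp

omit [IsUltrametricDist F] in
theorem IsCone.of_smul_mem {V : Set (Fin n → F)} (hV : IsCone Λ V) {l : Fˣ} (hl : l ∈ Λ)
    {ξ : Fin n → F} (h : (l : F) • ξ ∈ V) : ξ ∈ V := by
  have := hV.2 l⁻¹ (Λ.inv_mem hl) _ h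
  rwa [smul_smul, Units.val_inv_eq_inv_val, inv_mul_cancel₀ l.ne_zero, one_smul] at this

omit [IsUltrametricDist F] in
theorem IsClosedCone.isClosed_union {W : Set (Fin n → F)} (hW : IsClosedCone Λ W) :
    IsClosed {ξ | ξ ∈ W ∨ ξ = 0} := by
  refine isClosed_of_closure_subset fun ξ hξ => ?_
  by_cases h0 : ξ = 0
  · exact Or.inr h0
  · have h1 : ξ ∈ closure W ∪ closure {0} := by
      rw [← closure_union]
      exact hξ
    rcases h1 with h1 | h1
    · exact Or.inl (hW.2 ξ h1 h0)
    · rw [closure_singleton] at h1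
      exact Or.inr h1

/-- The directions of `E` in the annulus form a compact set, so the tube lemma separates `{y₀}`
times this set from the closure of `Γ`; homogeneity extends the separation to the whole cone. -/
theorem exists_disjoint_thick [ProperSpace F] (hϖ : ‖(ϖ : F)‖ < 1) (hϖΛ : ϖ ∈ Λ)
    {Y : Set (Fin n → F)} (hY : IsOpen Y) {Γ : Set ((Fin n → F) × (Fin n → F))}
    (hΓ : IsClosedConeOver Λ Y Γ) {E : Set (Fin n → F)} (hE : IsClosedCone Λ E)
    {y₀ : Fin n → F} (hy₀ : y₀ ∈ Y) (hdis : ∀ η ∈ E, (y₀, η) ∉ Γ) :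
    ∃ ε ρ, 0 < ε ∧ ε ≤ 1 ∧ 0 < ρ ∧ Metric.closedBall y₀ ρ ⊆ Y ∧
      ∀ y ∈ Metric.closedBall y₀ ρ, ∀ η ∈ thick E ε, (y, η) ∉ Γ := by
  have hϖ0 : 0 < ‖(ϖ : F)‖ := norm_pos_iff.2 ϖ.ne_zero
  set A := {v : Fin n → F | v ∈ E ∨ v = 0} ∩ {v | ‖(ϖ : F)‖ ≤ ‖v‖ ∧ ‖v‖ ≤ 1}
  have hA : IsCompact A := (isCompact_annulus _).inter_left hE.isClosed_union
  have hsub : ({y₀} : Set (Fin n → F)) ×ˢ A ⊆ (closure Γ)ᶜ := by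
    rintro ⟨y, η⟩ ⟨rfl, hη, hη1, -⟩ hcl
    have hη0 : η ≠ 0 := by
      rintro rfl
      rw [norm_zero] at hη1
      linarith
    exact hdis η (hη.resolve_right hη0) (hΓ.closed ⟨hcl, hy₀, hη0⟩)
  obtain ⟨U, V, hU, hV, hyU, hAV, hUV⟩ := generalized_tube_lemma isCompact_singleton hA
    isClosed_closure.isOpen_compl hsub
  obtain ⟨δ, hδ, hδV⟩ := hA.exists_thickening_subset_open hV hAV
  obtain ⟨ρ, hρ, hρU⟩ := Metric.nhds_basis_closedBall.mem_iff.1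
    (Filter.inter_mem (hU.mem_nhds (hyU rfl)) (hY.mem_nhds hy₀))
  refine ⟨min δ 1, ρ, by positivity, min_le_right _ _, hρ, fun z hz => (hρU hz).2, ?_⟩
  rintro y hy η hη hmem
  obtain ⟨l, hl, h1, h2⟩ := exists_smul_mem_annulus hϖ hϖΛ ((isCone_thick hE.1).1 η hη)
  obtain ⟨ζ, hζ, h3⟩ := (isCone_thick hE.1).2 l hl η hη
  have h4 : ‖ζ‖ = ‖(l : F) • η‖ := norm_eq_of_norm_sub_lt
    (h3.trans_le (mul_le_of_le_one_left (norm_nonneg _) (min_le_right _ _)))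
  have h5 : (l : F) • η ∈ V := by
    refine hδV (Metric.mem_thickening_iff.2 ⟨ζ, ⟨Or.inl hζ, ?_, ?_⟩, ?_⟩)
    · rwa [h4]
    · rwa [h4]
    · rw [dist_eq_norm]
      calc _ < min δ 1 * ‖(l : F) • η‖ := h3
        _ ≤ δ * 1 := by gcongr; exact min_le_left _ _
        _ = δ := mul_one _
  exact hUV ⟨(hρU hy).1, h5⟩ (subset_closure ((hΓ.cone l hl y η).1 hmem))

end Cones
-- The transposed derivative and the closedness of `f^*Γ`
section Codifferential

variable {F : Type*} [NontriviallyNormedField F] {m n : ℕ}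

theorem codiff_apply (f : (Fin m → F) → (Fin n → F)) (x : Fin m → F) (η : Fin n → F) (j : Fin m) :
    codiff f x η j = fderiv F f x (Pi.single j 1) ⬝ᵥ η := by
  simp [codiff, mulVec, dotProduct, LinearMap.toMatrix'_apply]

theorem dotProduct_codiff (f : (Fin m → F) → (Fin n → F)) (x v : Fin m → F) (η : Fin n → F) :
    v ⬝ᵥ codiff f x η = fderiv F f x v ⬝ᵥ η := by
  rw [codiff, dotProduct_mulVec, vecMul_transpose]
  congr 1
  exact LinearMap.toMatrix'_mulVec _ v

theorem codiff_smul (f : (Fin m → F) → (Fin n → F)) (x : Fin m → F) (c : F) (η : Fin n → F) :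
    codiff f x (c • η) = c • codiff f x η :=
  mulVec_smul _ _ _

@[simp]
theorem codiff_zero (f : (Fin m → F) → (Fin n → F)) (x : Fin m → F) : codiff f x 0 = 0 :=
  mulVec_zero _

theorem continuous_codiff (f : (Fin m → F) → (Fin n → F)) (x : Fin m → F) :
    Continuous (codiff f x) :=
  continuous_const.matrix_mulVec continuous_id

@[simp]
theorem codiff_id (x : Fin n → F) (η : Fin n → F) : codiff id x η = η := by
  ext j
  rw [codiff_apply, fderiv_id]
  simp

theorem norm_codiff_sub_le [IsUltrametricDist F] [CompleteSpace F]
    (f : (Fin m → F) → (Fin n → F)) (x y : Fin m → F) (η : Fin n → F) :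
    ‖codiff f x η - codiff f y η‖ ≤ ‖fderiv F f x - fderiv F f y‖ * ‖η‖ := by
  refine (pi_norm_le_iff_of_nonneg (by positivity)).2 fun j => ?_
  rw [Pi.sub_apply, codiff_apply, codiff_apply, ← sub_dotProduct]
  refine (norm_dotProduct_le _ _).trans ?_
  gcongr
  rw [← _root_.sub_apply]
  refine (ContinuousLinearMap.le_opNorm _ _).trans (le_of_eq ?_)
  rw [Pi.norm_single, norm_one, mul_one]

/-- The covectors at `f(x)` that `f'(x)^t` maps to `W ∪ {0}`. -/
def codiffPreimage (f : (Fin m → F) → (Fin n → F)) (x : Fin m → F) (W : Set (Fin m → F)) :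
    Set (Fin n → F) :=
  {η | η ≠ 0 ∧ (codiff f x η ∈ W ∨ codiff f x η = 0)}

theorem isClosedCone_codiffPreimage {Λ : Subgroup Fˣ} (f : (Fin m → F) → (Fin n → F))
    (x : Fin m → F) {W : Set (Fin m → F)} (hW : IsClosedCone Λ W) :
    IsClosedCone Λ (codiffPreimage f x W) := by
  refine ⟨⟨fun η hη => hη.1, ?_⟩, fun η hη h0 => ⟨h0, ?_⟩⟩
  · rintro l hl η ⟨h0, h⟩
    refine ⟨smul_ne_zero l.ne_zero h0, ?_⟩
    rw [codiff_smul]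
    rcases h with h | h
    · exact Or.inl (hW.1.2 l hl _ h)
    · exact Or.inr (by rw [h, smul_zero])
  · have hc : IsClosed (codiff f x ⁻¹' {ξ | ξ ∈ W ∨ ξ = 0}) :=
      hW.isClosed_union.preimage (continuous_codiff f x)
    exact closure_minimal (fun ζ hζ => hζ.2) hc hη

/-- The homogeneous function `‖f'(x)^t η - ξ‖` of the pair `(η, ξ)` has no nonzero zero on the given
closed cone: a zero has `f'(x)^t η = ξ ∈ W ∪ {0}`, which puts a nonzero `η` in the excluded
neighbourhood, while `η = 0` forces `ξ = 0`. -/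
theorem exists_codiff_lower_bound [IsUltrametricDist F] [ProperSpace F] {Λ : Subgroup Fˣ} {ϖ : Fˣ}
    (hϖ : ‖(ϖ : F)‖ < 1) (hϖΛ : ϖ ∈ Λ) (f : (Fin m → F) → (Fin n → F)) (x : Fin m → F)
    {W : Set (Fin m → F)} (hW : IsClosedCone Λ W) {ε : ℝ} (hε0 : 0 < ε) (hε1 : ε ≤ 1) :
    ∃ c, 0 < c ∧ c ≤ 1 ∧ ∀ η ∉ thick (codiffPreimage f x W) ε, ∀ ξ, ξ ∈ W ∨ ξ = 0 →
      c * max ‖η‖ ‖ξ‖ ≤ ‖codiff f x η - ξ‖ := by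
  have hE := isClosedCone_codiffPreimage f x hW
  obtain ⟨c, hc0, hc1, hc⟩ := exists_mul_norm_le (Λ := Λ) hϖ hϖΛ
    (E := (Fin n → F) × (Fin m → F))
    (C := (thick (codiffPreimage f x W) ε)ᶜ ×ˢ {ξ | ξ ∈ W ∨ ξ = 0})
    (g := fun p => ‖codiff f x p.1 - p.2‖)
    ((isOpen_thick hε0 hε1 hE.1).isClosed_compl.prod hW.isClosed_union)
    (by
      rintro l hl ⟨η, ξ⟩ ⟨h1, h2⟩
      refine ⟨fun h => h1 ((isCone_thick hE.1).of_smul_mem hl h), ?_⟩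
      rcases h2 with h2 | h2
      · exact Or.inl (hW.1.2 l hl _ h2)
      · refine Or.inr ?_
        simp only at h2
        simp [h2])
    (((continuous_codiff f x).comp continuous_fst).sub continuous_snd).norm
    (by
      intro l p
      simp only [Prod.smul_fst, Prod.smul_snd]
      rw [codiff_smul, ← smul_sub, norm_smul])
    (by
      rintro ⟨η, ξ⟩ ⟨h1, h2⟩ h0
      simp only
      rw [norm_pos_iff, sub_ne_zero]
      intro h
      by_cases hη : η = 0
      · rw [hη, codiff_zero] at h
        exact h0 (by rw [hη, ← h]; rfl)
      · exact h1 (subset_thick hε0 hE.1 ⟨hη, by rwa [h]⟩))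
    (fun _ => norm_nonneg _)
  exact ⟨c, hc0, hc1, fun η hη ξ hξ => hc (η, ξ) ⟨hη, hξ⟩⟩

variable [IsUltrametricDist F] [ProperSpace F] {Λ : Subgroup Fˣ} {ϖ : Fˣ}
  {X : Set (Fin m → F)} {Y : Set (Fin n → F)} {f : (Fin m → F) → (Fin n → F)}
  {Γ : Set ((Fin n → F) × (Fin n → F))}

omit [IsUltrametricDist F] [ProperSpace F] in
theorem codiff_ne_zero (hΓ : IsClosedConeOver Λ Y Γ)
    (hΓf : Γ ∩ normalSet f X = ∅) {x : Fin m → F} (hx : x ∈ X) {η : Fin n → F}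
    (h : (f x, η) ∈ Γ) : codiff f x η ≠ 0 := fun h0 =>
  (Set.eq_empty_iff_forall_notMem.1 hΓf) (f x, η) ⟨h, x, hx, rfl, (hΓ.subset h).2, h0⟩

/-- For closedness, let `f'(x_j)^t η_j → ξ₀ ≠ 0`. As `Γ` avoids the kernel of `f'(x₀)^t`, the `η_j`
are bounded, and a subsequential limit lies in `Γ`; it is nonzero because it maps to `ξ₀`. -/
theorem isClosedConeOver_pullbackCone (hϖ : ‖(ϖ : F)‖ < 1) (hϖΛ : ϖ ∈ Λ)
    (hf : AnalyticOnNhd F f X) (hXY : MapsTo f X Y) (hY : IsOpen Y)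
    (hΓ : IsClosedConeOver Λ Y Γ) (hΓf : Γ ∩ normalSet f X = ∅) :
    IsClosedConeOver Λ X (pullbackCone f X Γ) := by
  refine ⟨?_, ?_, ?_⟩
  · rintro ⟨x, ξ⟩ ⟨hx, η, hη, h⟩
    refine ⟨hx, ?_⟩
    rw [mem_compl_singleton_iff, h]
    exact codiff_ne_zero hΓ hΓf hx hη
  · intro l hl x ξ
    constructor
    · rintro ⟨hx, η, hη, h⟩
      refine ⟨hx, (l : F) • η, (hΓ.cone l hl _ _).1 hη, ?_⟩
      simp only at h ⊢
      rw [codiff_smul, h]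
    · rintro ⟨hx, η, hη, h⟩
      refine ⟨hx, ((l⁻¹ : Fˣ) : F) • η, (hΓ.cone l⁻¹ (Λ.inv_mem hl) _ _).1 hη, ?_⟩
      simp only at h ⊢
      rw [codiff_smul, ← h, smul_smul, Units.inv_mul, one_smul]
  · rintro ⟨x₀, ξ₀⟩ ⟨hcl, hx₀, hξ₀⟩
    -- With `W = ∅` the set `codiffPreimage f x₀ W` is the kernel of `f'(x₀)^t` without the origin.
    have hW : IsClosedCone Λ (∅ : Set (Fin m → F)) := by
      refine ⟨⟨by simp, by simp⟩, by simp⟩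
    obtain ⟨ε, ρ, hε0, hε1, hρ, -, hdis⟩ := exists_disjoint_thick hϖ hϖΛ hY hΓ
      (isClosedCone_codiffPreimage f x₀ hW) (hXY hx₀) (by
        rintro η ⟨-, h⟩ hη
        exact codiff_ne_zero hΓ hΓf hx₀ hη (h.resolve_left (by simp)))
    obtain ⟨c, hc0, -, hc⟩ := exists_codiff_lower_bound hϖ hϖΛ f x₀ hW hε0 hε1
    obtain ⟨p, hp, hlim⟩ := mem_closure_iff_seq_limit.1 hcl
    have hlim1 : Tendsto (fun j => (p j).1) atTop (𝓝 x₀) :=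
      (continuous_fst.tendsto _).comp hlim
    have hlim2 : Tendsto (fun j => (p j).2) atTop (𝓝 ξ₀) :=
      (continuous_snd.tendsto _).comp hlim
    choose hpX η hηΓ hpη using hp
    have hfc := (hf x₀ hx₀).continuousAt
    have hdc : Tendsto (fun j => ‖fderiv F f (p j).1 - fderiv F f x₀‖) atTop (𝓝 0) := by
      have := ((hf.fderiv x₀ hx₀).continuousAt.tendsto.comp hlim1).sub_const (fderiv F f x₀)
      simpa using this.norm
    have hbound : ∀ᶠ j in atTop, ‖η j‖ ≤ (‖ξ₀‖ + 1) / c := by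
      filter_upwards [(hfc.tendsto.comp hlim1).eventually (Metric.closedBall_mem_nhds _ hρ),
        hdc.eventually (gt_mem_nhds hc0),
        hlim2.norm.eventually (gt_mem_nhds (lt_add_one ‖ξ₀‖))] with j h1 h2 h3
      have h4 : c * ‖η j‖ ≤ ‖codiff f x₀ (η j)‖ := by
        have := hc (η j) (fun h => hdis _ h1 _ h (hηΓ j)) 0 (Or.inr rfl)
        simpa using this
      by_cases h0 : η j = 0
      · rw [h0, norm_zero]
        positivity
      have h5 : ‖codiff f x₀ (η j) - codiff f (p j).1 (η j)‖ < ‖codiff f x₀ (η j)‖ := by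
        rw [norm_sub_rev]
        refine (norm_codiff_sub_le _ _ _ _).trans_lt (lt_of_lt_of_le ?_ h4)
        exact mul_lt_mul_of_pos_right h2 (norm_pos_iff.2 h0)
      rw [← norm_eq_of_norm_sub_lt h5, ← hpη] at h4
      rw [le_div_iff₀ hc0]
      linarith
    obtain ⟨η₀, -, σ, hσ, hση⟩ := tendsto_subseq_of_frequently_bounded
      (Metric.isBounded_closedBall (x := (0 : Fin n → F)) (r := (‖ξ₀‖ + 1) / c))
      (hbound.frequently.mono fun j hj => by simpa using hj)
    have hcod : codiff f x₀ η₀ = ξ₀ := by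
      have h1 : Tendsto (fun j => codiff f x₀ (η (σ j))) atTop (𝓝 (codiff f x₀ η₀)) :=
        ((continuous_codiff f x₀).tendsto _).comp hση
      have h2 : Tendsto (fun j => codiff f (p (σ j)).1 (η (σ j)) - codiff f x₀ (η (σ j)))
          atTop (𝓝 0) := by
        refine squeeze_zero_norm (fun j => norm_codiff_sub_le _ _ _ _) ?_
        have := (hdc.comp hσ.tendsto_atTop).mul hση.norm
        simpa using this
      have h3 := h2.add h1
      simp only [sub_add_cancel, zero_add, ← hpη] at h3
      exact tendsto_nhds_unique h3 (hlim2.comp hσ.tendsto_atTop)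
    refine ⟨hx₀, η₀, hΓ.closed ⟨?_, hXY hx₀, ?_⟩, hcod.symm⟩
    · have h1 : Tendsto (fun j => (f (p (σ j)).1, η (σ j))) atTop (𝓝 (f x₀, η₀)) :=
        ((hfc.tendsto.comp hlim1).comp hσ.tendsto_atTop).prodMk_nhds hση
      exact mem_closure_of_tendsto h1 (Eventually.of_forall fun j => hηΓ _)
    · rintro rfl
      rw [codiff_zero] at hcod
      exact hξ₀ hcod.symm

end Codifferential

/-! ### Wave front sets are closed cones -/

section WaveFront

variable {F : Type*} [NontriviallyNormedField F] {n : ℕ} {Λ : Subgroup Fˣ}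

theorem isCone_preimage_smul {V : Set (Fin n → F)} (hV : IsCone Λ V) {l : Fˣ} (hl : l ∈ Λ)
    {ξ : Fin n → F} : (l : F) • ξ ∈ V ↔ ξ ∈ V :=
  ⟨hV.of_smul_mem hl, hV.2 l hl ξ⟩

theorem smul_mem_asymptoticCone {A : Set (Fin n → F)} {l : Fˣ} (hl : l ∈ Λ) {ξ : Fin n → F} :
    (l : F) • ξ ∈ asymptoticCone Λ A ↔ ξ ∈ asymptoticCone Λ A := by
  have h0 : (l : F) • ξ ≠ 0 ↔ ξ ≠ 0 := by simp
  constructor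
  · rintro ⟨h1, h2⟩
    exact ⟨h0.1 h1, fun V hV hVc h => h2 V hV hVc ((isCone_preimage_smul hVc hl).2 h)⟩
  · rintro ⟨h1, h2⟩
    exact ⟨h0.2 h1, fun V hV hVc h => h2 V hV hVc ((isCone_preimage_smul hVc hl).1 h)⟩

/-- For closedness, a test function `φ` and an open cone `V` used at `(x, ξ)` also serve at all
nearby points. -/
theorem isClosedConeOver_WF (χ : StdChar F) {X : Set (Fin n → F)} (u : Dist X) :
    IsClosedConeOver Λ X (WF χ Λ u) := by
  refine ⟨fun z hz => ⟨hz.1, hz.2.1⟩, ?_, ?_⟩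
  · intro l hl x ξ
    have h0 : (l : F) • ξ ≠ 0 ↔ ξ ≠ 0 := by simp
    simp only [WF, mem_ofPred_eq, smul_mem_asymptoticCone hl, h0]
  · rintro ⟨x, ξ⟩ ⟨hcl, hx, hξ⟩
    refine ⟨hx, hξ, fun φ hφ => ⟨hξ, fun V hV hVc hξV => ?_⟩⟩
    have hopen : IsOpen ({z | φ.1 z ≠ 0} ×ˢ V) :=
      IsOpen.prod (φ.2.1 {z | z ≠ 0}) hV
    obtain ⟨⟨y, η⟩, ⟨hy, hη⟩, hyη⟩ := mem_closure_iff.1 hcl _ hopen ⟨hφ, hξV⟩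
    exact (hyη.2.2 φ hy).2 V hV hVc hη

end WaveFront
-- Uniform control of Fourier supports
section UniformWF

variable {F : Type*} [NontriviallyNormedField F] {m n : ℕ} {Λ : Subgroup Fˣ} {ϖ : Fˣ}

/-- The Fourier transforms of the localizations of the distributions in `U` have uniformly bounded
support in each closed cone that avoids `Γ` over the support of the localization. -/
def UniformWF (χ : StdChar F) (Λ : Subgroup Fˣ) {X : Set (Fin n → F)}
    (Γ : Set ((Fin n → F) × (Fin n → F))) (U : Set (Dist X)) : Prop :=
  ∀ (φ : SB X) (V : Set (Fin n → F)), IsClosedCone Λ V → Γ ∩ tsupport φ.1 ×ˢ V = ∅ →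
    ∃ R, ∀ u ∈ U, ∀ ξ ∈ V, R < ‖ξ‖ → fourierMul χ φ u ξ = 0

theorem fourierMul_zero (χ : StdChar F) {X : Set (Fin n → F)} (u : Dist X) (ξ : Fin n → F) :
    fourierMul χ 0 u ξ = 0 := by
  simp [fourierMul]

theorem fourierMul_add (χ : StdChar F) {X : Set (Fin n → F)} (φ ψ : SB X) (u : Dist X)
    (ξ : Fin n → F) : fourierMul χ (φ + ψ) u ξ = fourierMul χ φ u ξ + fourierMul χ ψ u ξ := by
  simp [fourierMul]

theorem fourierMul_smul (χ : StdChar F) {X : Set (Fin n → F)} (c : ℂ) (φ : SB X) (u : Dist X)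
    (ξ : Fin n → F) : fourierMul χ (c • φ) u ξ = c * fourierMul χ φ u ξ := by
  simp [fourierMul]

variable [IsUltrametricDist F]

theorem isBounded_tsupport_fourierMul_inter_iff (χ : StdChar F) {X : Set (Fin n → F)} (φ : SB X)
    (u : Dist X) (V : Set (Fin n → F)) :
    Bornology.IsBounded (tsupport (fourierMul χ φ u) ∩ V) ↔
      ∃ R, ∀ ξ ∈ V, R < ‖ξ‖ → fourierMul χ φ u ξ = 0 := by
  rw [isBounded_iff_forall_norm_le]
  refine exists_congr fun R => ?_
  constructor
  · intro h ξ hξ hR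
    by_contra hne
    exact absurd (h ξ ⟨(mem_tsupport_fourierMul χ φ u).2 hne, hξ⟩) (not_le.2 hR)
  · rintro h ξ ⟨h1, h2⟩
    by_contra hR
    exact (mem_tsupport_fourierMul χ φ u).1 h1 (h ξ h2 (not_le.1 hR))

theorem isBounded_iUnion_tsupport_inter_iff (χ : StdChar F) {X : Set (Fin n → F)} (φ : SB X)
    (u : ℕ → Dist X) (V : Set (Fin n → F)) :
    Bornology.IsBounded ((⋃ j, tsupport (fourierMul χ φ (u j))) ∩ V) ↔
      ∃ R, ∀ j, ∀ ξ ∈ V, R < ‖ξ‖ → fourierMul χ φ (u j) ξ = 0 := by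
  rw [isBounded_iff_forall_norm_le]
  refine exists_congr fun R => ?_
  constructor
  · intro h j ξ hξ hR
    by_contra hne
    exact absurd (h ξ ⟨mem_iUnion.2 ⟨j, (mem_tsupport_fourierMul χ φ (u j)).2 hne⟩, hξ⟩)
      (not_le.2 hR)
  · rintro h ξ ⟨h1, h2⟩
    by_contra hR
    obtain ⟨j, hj⟩ := mem_iUnion.1 h1
    exact (mem_tsupport_fourierMul χ φ (u j)).1 hj (h j ξ h2 (not_le.1 hR))

variable [ProperSpace F] [MeasurableSpace F] [BorelSpace F]

/-- Localizing further a localized distribution does not enlarge the support of its Fourier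
transform, up to passing to a narrower cone. -/
theorem fourierMul_ballSB_eq_zero (χ : StdChar F) {X : Set (Fin n → F)} (u : Dist X)
    {E : Set (Fin n → F)} {ε R : ℝ} (hε0 : 0 < ε) (hε1 : ε ≤ 1) {φ : SB X}
    (h : ∀ ξ ∈ thick E ε, R < ‖ξ‖ → fourierMul χ φ u ξ = 0) {a : F} (ha : a ≠ 0)
    {y : Fin n → F} {c : ℂ} (hc : c ≠ 0) (hy : Metric.closedBall y ‖a‖ ⊆ X)
    (hφ : ∀ z ∈ Metric.closedBall y ‖a‖, φ.1 z = c) {ξ : Fin n → F} (hξ : ξ ∈ thick E ε)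
    (hR : max R (‖a‖⁻¹ / ε) < ‖ξ‖) : fourierMul χ (ballSB X ‖a‖ y) u ξ = 0 := by
  -- Up to a nonzero factor, the transform at `ξ` is an average of values of `𝓕(φu)` at `ξ + η` with
  -- `‖η‖ ≤ ‖a‖⁻¹`, twisted by a character. For large `ξ` these points stay in the cone.
  have h1 := integral_char_mul_fourierMul χ ha (u ∘ₗ mulSB (charFn χ X ξ)) φ hy hφ
  have hvol : ballVol F n ‖a‖⁻¹ ≠ 0 := right_ne_zero_of_mul_eq_one (ballVol_mul_inv ha)
  have h2 : ∀ η, (Metric.closedBall 0 ‖a‖⁻¹).indicator (fun η => χ.toAddChar (y ⬝ᵥ η) *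
      fourierMul χ φ (u ∘ₗ mulSB (charFn χ X ξ)) η) η = 0 := by
    intro η
    refine indicator_apply_eq_zero.2 fun hη => ?_
    have h3 : ‖η‖ < ε * ‖ξ‖ := by
      rw [mem_closedBall_zero_iff] at hη
      refine hη.trans_lt ?_
      rw [mul_comm, ← div_lt_iff₀ hε0]
      exact (le_max_right _ _).trans_lt hR
    have h4 : ‖ξ + η‖ = ‖ξ‖ := by
      refine norm_eq_of_norm_sub_lt ?_
      rw [sub_add_cancel_left, norm_neg]
      exact h3.trans_le (mul_le_of_le_one_left (norm_nonneg _) hε1)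
    have h5 : fourierMul χ φ (u ∘ₗ mulSB (charFn χ X ξ)) η = fourierMul χ φ u (ξ + η) := by
      simp [fourierMul, mulSB_charFn_add]
    rw [h5, h _ (add_mem_thick hε1 hξ h3) (by
      rw [h4]
      exact (le_max_left _ _).trans_lt hR), mul_zero]
  simp_rw [h2] at h1
  rw [integral_zero] at h1
  exact (mul_eq_zero.1 h1.symm).resolve_left (mul_ne_zero hvol hc)

/-- The definition of the wave front set only provides, for each point and direction outside it,
some adapted test function. Small balls near the point inherit the bound on a narrower cone.
Compactness of the directions and of the support of `φ` then gives the bound for arbitrary `φ`. -/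
theorem uniformWF_singleton (χ : StdChar F) (hϖ : ‖(ϖ : F)‖ < 1) (hϖΛ : ϖ ∈ Λ)
    {X : Set (Fin n → F)} (u : Dist X) : UniformWF χ Λ (WF χ Λ u) {u} := by
  intro φ V hV hdis
  simp only [mem_singleton_iff, forall_eq]
  refine SB.ball_induction ϖ.ne_zero hϖ φ
    (P := fun φ => ∃ R, ∀ ξ ∈ V, R < ‖ξ‖ → fourierMul χ φ u ξ = 0) ?_ ?_ ?_ ?_
  · exact ⟨0, fun ξ _ _ => fourierMul_zero χ u ξ⟩
  · rintro a b ⟨R₁, h₁⟩ ⟨R₂, h₂⟩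
    refine ⟨max R₁ R₂, fun ξ hξ hR => ?_⟩
    rw [fourierMul_add, h₁ ξ hξ ((le_max_left _ _).trans_lt hR),
      h₂ ξ hξ ((le_max_right _ _).trans_lt hR), add_zero]
  · rintro c a ⟨R, h⟩
    refine ⟨R, fun ξ hξ hR => ?_⟩
    rw [fourierMul_smul, h ξ hξ hR, mul_zero]
  · intro x hx
    have hcpt : IsCompact ({v : Fin n → F | v ∈ V ∨ v = 0} ∩ {v | ‖(ϖ : F)‖ ≤ ‖v‖ ∧ ‖v‖ ≤ 1}) :=
      (isCompact_annulus _).inter_left hV.isClosed_union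
    -- The factor `l ∈ Λ` spreads the bound from the compact annulus over all of `V`. The radius `δ`
    -- is common to all balls, whereas `R` may depend on the ball.
    have key : ∃ δ > 0, ∀ (k : ℕ) (y : Fin n → F),
        Metric.closedBall y (‖(ϖ : F)‖ ^ k) ⊆ Metric.ball x δ →
        Metric.closedBall y (‖(ϖ : F)‖ ^ k) ⊆ X → ∃ R, ∀ l ∈ Λ,
          ∀ ξ ∈ {v : Fin n → F | v ∈ V ∨ v = 0} ∩ {v | ‖(ϖ : F)‖ ≤ ‖v‖ ∧ ‖v‖ ≤ 1},
          R < ‖(l : F) • ξ‖ →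
            fourierMul χ (ballSB X (‖(ϖ : F)‖ ^ k) y) u ((l : F) • ξ) = 0 := by
      refine hcpt.induction_on
        (p := fun S => ∃ δ > 0, ∀ (k : ℕ) (y : Fin n → F),
          Metric.closedBall y (‖(ϖ : F)‖ ^ k) ⊆ Metric.ball x δ →
          Metric.closedBall y (‖(ϖ : F)‖ ^ k) ⊆ X → ∃ R, ∀ l ∈ Λ, ∀ ξ ∈ S, R < ‖(l : F) • ξ‖ →
            fourierMul χ (ballSB X (‖(ϖ : F)‖ ^ k) y) u ((l : F) • ξ) = 0) ?_ ?_ ?_ ?_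
      · exact ⟨1, one_pos, fun k y _ _ => ⟨0, fun l _ ξ hξ => hξ.elim⟩⟩
      · rintro S S' hS ⟨δ, hδ, h⟩
        refine ⟨δ, hδ, fun k y h1 h2 => ?_⟩
        obtain ⟨R, hR⟩ := h k y h1 h2
        exact ⟨R, fun l hl ξ hξ => hR l hl ξ (hS hξ)⟩
      · rintro S S' ⟨δ, hδ, h⟩ ⟨δ', hδ', h'⟩
        refine ⟨min δ δ', lt_min hδ hδ', fun k y h1 h2 => ?_⟩
        obtain ⟨R, hR⟩ := h k y (h1.trans (Metric.ball_subset_ball (min_le_left _ _))) h2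
        obtain ⟨R', hR'⟩ := h' k y (h1.trans (Metric.ball_subset_ball (min_le_right _ _))) h2
        refine ⟨max R R', fun l hl ξ hξ hlt => ?_⟩
        rcases hξ with hξ | hξ
        · exact hR l hl ξ hξ ((le_max_left _ _).trans_lt hlt)
        · exact hR' l hl ξ hξ ((le_max_right _ _).trans_lt hlt)
      · rintro ξ ⟨hξV, hξ1, -⟩
        have hξ0 : ξ ≠ 0 := by
          rintro rfl
          rw [norm_zero] at hξ1
          exact absurd hξ1 (not_le.2 (norm_pos_iff.2 ϖ.ne_zero))
        have hnot : (x, ξ) ∉ WF χ Λ u := fun h =>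
          (Set.eq_empty_iff_forall_notMem.1 hdis) (x, ξ) ⟨h, hx, hξV.resolve_right hξ0⟩
        have hxX : x ∈ X := φ.2.2.2 hx
        simp only [WF, mem_ofPred_eq, not_and, not_forall] at hnot
        obtain ⟨ψ, hψ, hAC⟩ := hnot hxX hξ0
        simp only [asymptoticCone, mem_ofPred_eq, not_and, not_forall, not_not] at hAC
        obtain ⟨V', hV', hVc', hξV', hb⟩ := hAC hξ0
        obtain ⟨R, hR⟩ := (isBounded_tsupport_fourierMul_inter_iff χ ψ u V').1 hb
        obtain ⟨ε, hε0, hε1, hε⟩ := exists_thick_orbit (Λ := Λ) hV' hξV' hξ0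
        obtain ⟨δ, hδ, hδψ⟩ := Metric.eventually_nhds_iff.1
          ((IsLocallyConstant.iff_eventually_eq ψ.1).1 ψ.2.1 x)
        have hcone := isCone_orbit (Λ := Λ) hξ0
        refine ⟨thick (orbit Λ ξ) ε, mem_nhdsWithin_of_mem_nhds ((isOpen_thick hε0 hε1
          hcone).mem_nhds (subset_thick hε0 hcone (mem_orbit_self ξ))), δ, hδ,
          fun k y h1 h2 => ?_⟩
        rw [← norm_pow] at h1 h2 ⊢
        refine ⟨max R (‖(ϖ : F) ^ k‖⁻¹ / ε), fun l hl ζ hζ hlt => ?_⟩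
        refine fourierMul_ballSB_eq_zero χ u hε0 hε1 (φ := ψ) (R := R) (E := orbit Λ ξ) ?_
          (pow_ne_zero _ ϖ.ne_zero) hψ h2 (fun z hz => hδψ (h1 hz))
          ((isCone_thick hcone).2 l hl ζ hζ) hlt
        intro η hη
        obtain ⟨l', hl', h'⟩ := hε η hη
        exact hR η (hVc'.of_smul_mem hl' h')
    obtain ⟨δ, hδ, h⟩ := key
    refine ⟨δ, hδ, fun k y h1 h2 => ?_⟩
    obtain ⟨R, hR⟩ := h k y h1 h2
    refine ⟨R, fun ξ hξ hlt => ?_⟩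
    obtain ⟨l, hl, h3, h4⟩ := exists_smul_mem_annulus hϖ hϖΛ (hV.1.1 ξ hξ)
    have h5 := hR l⁻¹ (Λ.inv_mem hl) ((l : F) • ξ) ⟨Or.inl (hV.1.2 l hl ξ hξ), h3, h4⟩
    rw [smul_smul, Units.inv_mul, one_smul] at h5
    exact h5 hlt

/-- The transform of a localized smooth function has bounded support, so even the cone of all
nonzero vectors meets it in a bounded set. -/
theorem WF_ofSmooth (χ : StdChar F) (hϖ : ‖(ϖ : F)‖ < 1) {X : Set (Fin n → F)}
    (hX : IsOpen X) (g : Smooth X) : WF χ Λ (ofSmooth g) = ∅ := by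
  refine Set.eq_empty_iff_forall_notMem.2 ?_
  rintro ⟨x, ξ⟩ ⟨hx, hξ, h⟩
  obtain ⟨r, hr, hrX⟩ := Metric.nhds_basis_closedBall.mem_iff.1 (hX.mem_nhds hx)
  have h1 := h (ballSB X r x) (by
    rw [ballSB_apply hr hrX, indicator_of_mem (Metric.mem_closedBall_self hr.le)]
    exact one_ne_zero)
  refine h1.2 {0}ᶜ isOpen_compl_singleton ⟨fun _ h => h, fun l _ ζ hζ => ?_⟩ hξ ?_
  · exact smul_ne_zero l.ne_zero hζ
  · rw [isBounded_tsupport_fourierMul_inter_iff]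
    obtain ⟨R, hR⟩ := exists_fourierMul_ofSmooth_eq_zero χ ϖ.ne_zero hϖ g (ballSB X r x)
    exact ⟨R, fun ξ _ => hR ξ⟩

end UniformWF

/-! ### Stationarity of the regularized pullbacks -/

section Pullback

variable {F : Type*} [NontriviallyNormedField F] [IsUltrametricDist F] [ProperSpace F]
  [MeasurableSpace F] [BorelSpace F] {m n : ℕ} {Λ : Subgroup Fˣ} {ϖ : Fˣ}
  {X : Set (Fin m → F)} {Y : Set (Fin n → F)} {f : (Fin m → F) → (Fin n → F)}
  {Γ : Set ((Fin n → F) × (Fin n → F))}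

/-- The regularized pullbacks of the distributions in `U`, tested against `φ`, become stationary,
and their Fourier transforms vanish for large frequencies in `W`, uniformly in `U`. -/
def Stationary (χ : StdChar F) (ϖ : Fˣ) (hf : AnalyticOnNhd F f X) (hXY : MapsTo f X Y)
    (U : Set (Dist Y)) (W : Set (Fin m → F)) (φ : SB X) : Prop :=
  ∃ (R : ℝ) (k₀ : ℕ), ∀ u ∈ U, ∀ k ≥ k₀,
    regPullback hf hXY (‖(ϖ : F)‖ ^ k) u φ = regPullback hf hXY (‖(ϖ : F)‖ ^ k₀) u φ ∧
    ∀ ξ ∈ W, R < ‖ξ‖ →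
      regPullback hf hXY (‖(ϖ : F)‖ ^ k) u (mulSB (charFn χ X ξ) φ) = 0

/-- For large `(η, ξ)` either the Fourier transform of the localized distribution or the oscillatory
integral vanishes. Enlarging the frequency cutoff `1/r` beyond this range changes nothing. -/
theorem exists_stationary_ballSB (χ : StdChar F) (hϖ : ‖(ϖ : F)‖ < 1) (hϖΛ : ϖ ∈ Λ)
    (hf : AnalyticOnNhd F f X) (hXY : MapsTo f X Y) (hY : IsOpen Y)
    (hΓ : IsClosedConeOver Λ Y Γ) (hΓf : Γ ∩ normalSet f X = ∅)
    {U : Set (Dist Y)} (hU : UniformWF χ Λ Γ U) {W : Set (Fin m → F)} (hW : IsClosedCone Λ W)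
    {x₀ : Fin m → F} (hx₀ : x₀ ∈ X) (hdis : ∀ η, (f x₀, η) ∈ Γ → codiff f x₀ η ∉ W) :
    ∃ δ > 0, ∀ (k : ℕ) (y : Fin m → F),
      Metric.closedBall y (‖(ϖ : F)‖ ^ k) ⊆ Metric.ball x₀ δ →
      Metric.closedBall y (‖(ϖ : F)‖ ^ k) ⊆ X →
        Stationary χ ϖ hf hXY U W (ballSB X (‖(ϖ : F)‖ ^ k) y) := by
  have hϖ0 : 0 < ‖(ϖ : F)‖ := norm_pos_iff.2 ϖ.ne_zero
  have hE := isClosedCone_codiffPreimage f x₀ hW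
  obtain ⟨ε, ρ, hε0, hε1, hρ, hρY, hthick⟩ := exists_disjoint_thick hϖ hϖΛ hY hΓ hE (hXY hx₀) (by
    rintro η ⟨-, h | h⟩ hη
    · exact hdis η hη h
    · exact codiff_ne_zero hΓ hΓf hx₀ hη h)
  obtain ⟨c, hc0, hc1, hc⟩ := exists_codiff_lower_bound hϖ hϖΛ f x₀ hW hε0 hε1
  set V := thick (codiffPreimage f x₀ W) ε
  set ψ := ballSB Y ρ (f x₀)
  obtain ⟨R₀, hR₀⟩ := hU ψ V (isClosedCone_thick hε0 hε1 hE.1) (by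
    refine Set.eq_empty_iff_forall_notMem.2 ?_
    rintro ⟨y, η⟩ ⟨h1, h2, h3⟩
    rw [SB.mem_tsupport, ballSB_apply hρ hρY] at h2
    exact hthick y (by_contra fun h => h2 (indicator_of_notMem h _)) η h3 h1)
  obtain ⟨C, hC⟩ := ((isCompact_closedBall (0 : Fin n → F) R₀).image
    (continuous_codiff f x₀)).isBounded.exists_norm_le
  have hC' : ∀ η : Fin n → F, ‖η‖ ≤ R₀ → ‖codiff f x₀ η‖ ≤ C := fun η hη =>
    hC _ ⟨η, by simpa using hη, rfl⟩
  -- The tolerance `c‖ϖ‖` is what `integral_char_eq_zero` allows against a phase gradient of size at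
  -- least `c max(‖η‖, ‖ξ‖)`.
  have hstrict := (hf x₀ hx₀).hasStrictFDerivAt.isLittleO.def (mul_pos hc0 hϖ0)
  rw [nhds_prod_eq, eventually_prod_self_iff'] at hstrict
  obtain ⟨S, hS, hSf⟩ := hstrict
  obtain ⟨δ, hδ, hδS⟩ := Metric.mem_nhds_iff.1 (Filter.inter_mem hS
    ((hf x₀ hx₀).continuousAt.preimage_mem_nhds (Metric.closedBall_mem_nhds (f x₀) hρ)))
  refine ⟨δ, hδ, fun k y hy hyX => ?_⟩
  set s := ‖(ϖ : F)‖ ^ k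
  have hs : 0 < s := by positivity
  set φ := ballSB X s y
  have hφ1 : ∀ x, φ.1 x ≠ 0 → x ∈ Metric.closedBall y s := fun x hx => by
    rw [ballSB_apply hs hyX] at hx
    exact by_contra fun h => hx (indicator_of_notMem h _)
  have hφs : ∀ x v, ‖v‖ ≤ s → φ.1 (x + v) = φ.1 x := by
    intro x v hv
    have h1 : x + v ∈ Metric.closedBall x s := by simpa [dist_eq_norm] using hv
    have h2 : x + v ∈ Metric.closedBall y s ↔ x ∈ Metric.closedBall y s := by
      rw [Metric.mem_closedBall_comm, Metric.mem_closedBall_comm (x := x),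
        IsUltrametricDist.closedBall_eq_of_mem h1]
    rw [ballSB_apply hs hyX, ballSB_apply hs hyX]
    by_cases hx : x ∈ Metric.closedBall y s
    · rw [indicator_of_mem hx, indicator_of_mem (h2.2 hx)]
    · rw [indicator_of_notMem hx, indicator_of_notMem (mt h2.1 hx)]
  -- Beyond `R₀` the transforms vanish on `V`; beyond `C` the frequency `ξ` dominates `f'(x₀)^t η`
  -- for `‖η‖ ≤ R₀`; the last term makes the shift in the phase argument at most the radius `s` of
  -- `φ`.
  set R := max (max R₀ C) (c * s * ‖(ϖ : F)‖)⁻¹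
  have hR0 : 0 < R := lt_max_of_lt_right (by positivity)
  have hzero : ∀ u ∈ U, ∀ η ξ, ξ ∈ W ∨ ξ = 0 → R < max ‖η‖ ‖ξ‖ →
      fourierMul χ ψ u η *
        ∫ x, χ.toAddChar (f x ⬝ᵥ η - x ⬝ᵥ ξ) * φ.1 x ∂haar F m = 0 := by
    intro u hu η ξ hξ hlt
    by_cases hη : η ∈ V ∧ R₀ < ‖η‖
    · rw [hR₀ u hu η hη.1 hη.2, zero_mul]
    have hθ : c * max ‖η‖ ‖ξ‖ ≤ ‖codiff f x₀ η - ξ‖ := by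
      by_cases hηV : η ∈ V
      · have h1 : ‖η‖ ≤ R₀ := not_lt.1 fun h => hη ⟨hηV, h⟩
        have h2 : ‖η‖ ≤ R := h1.trans ((le_max_left _ _).trans (le_max_left _ _))
        have h3 : R < ‖ξ‖ := (lt_max_iff.1 hlt).resolve_left (not_lt.2 h2)
        have h4 : ‖codiff f x₀ η‖ < ‖ξ‖ :=
          (hC' η h1).trans_lt (((le_max_right _ _).trans (le_max_left _ _)).trans_lt h3)
        have h5 : ‖ξ - codiff f x₀ η‖ = ‖ξ‖ := norm_eq_of_norm_sub_lt (by simpa using h4)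
        rw [norm_sub_rev, h5, max_eq_right (h2.trans h3.le)]
        exact mul_le_of_le_one_left (norm_nonneg _) hc1
      · exact hc η hηV ξ hξ
    rw [integral_char_eq_zero χ ϖ.ne_zero hϖ (L := fderiv F f x₀)
      (θ := codiff f x₀ η - ξ) (ε := c * ‖(ϖ : F)‖) (s := s) (by positivity) ?_ ?_ hφs ?_ ?_,
      mul_zero]
    · intro x v hx hxv
      have h1 := hSf (x + v) (hδS (hy (hφ1 _ hxv))).1 x (hδS (hy (hφ1 _ hx))).1
      simpa using h1
    · intro v
      rw [dotProduct_sub, dotProduct_codiff]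
    · have h1 : (c * s * ‖(ϖ : F)‖)⁻¹ < max ‖η‖ ‖ξ‖ := (le_max_right _ _).trans_lt hlt
      calc (1 : ℝ) = c * s * ‖(ϖ : F)‖ * (c * s * ‖(ϖ : F)‖)⁻¹ :=
            (mul_inv_cancel₀ (by positivity)).symm
        _ ≤ c * s * ‖(ϖ : F)‖ * max ‖η‖ ‖ξ‖ := by gcongr
        _ = s * ‖(ϖ : F)‖ * (c * max ‖η‖ ‖ξ‖) := by ring
        _ ≤ _ := by gcongr
    · calc c * ‖(ϖ : F)‖ * ‖η‖ = ‖(ϖ : F)‖ * (c * ‖η‖) := by ring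
        _ ≤ ‖(ϖ : F)‖ * (c * max ‖η‖ ‖ξ‖) := by gcongr; exact le_max_left _ _
        _ ≤ _ := by gcongr
  -- Radii below `ρ` permit Fourier inversion with `ψ`; radii below `1/R` put the ball `‖η‖ ≤ R`
  -- inside the cutoff.
  obtain ⟨k₀, hk₀⟩ := exists_pow_lt_of_lt_one (lt_min hρ (inv_pos.2 hR0)) hϖ
  have hkk : ∀ k ≥ k₀, ‖(ϖ : F)‖ ^ k ≤ ‖(ϖ : F)‖ ^ k₀ := fun k hk =>
    pow_le_pow_of_le_one hϖ0.le hϖ.le hk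
  have hRk : ∀ k ≥ k₀, R ≤ ‖(ϖ : F) ^ k‖⁻¹ := fun k hk => by
    rw [norm_pow, le_inv_comm₀ hR0 (by positivity)]
    exact (hkk k hk).trans (hk₀.le.trans (min_le_right _ _))
  have hform : ∀ u : Dist Y, ∀ k ≥ k₀, ∀ ξ,
      regPullback hf hXY (‖(ϖ : F)‖ ^ k) u (mulSB (charFn χ X ξ) φ) =
      ∫ η, (Metric.closedBall 0 ‖(ϖ : F) ^ k‖⁻¹).indicator (fun η => fourierMul χ ψ u η *
        ∫ x, χ.toAddChar (f x ⬝ᵥ η - x ⬝ᵥ ξ) * φ.1 x ∂haar F m) η ∂haar F n := by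
    intro u k hk ξ
    have h1 := regPullback_mulSB_charFn hf hXY χ (pow_ne_zero k ϖ.ne_zero) u φ hρY (by
      rw [norm_pow]
      exact (hkk k hk).trans (hk₀.le.trans (min_le_left _ _)))
      (fun x hx => (hδS (hy (hφ1 _ hx))).2) ξ
    rw [← h1, norm_pow]
  refine ⟨R, k₀, fun u hu k hk => ⟨?_, fun ξ hξ hlt => ?_⟩⟩
  · have h1 := hform u k hk 0
    have h2 := hform u k₀ le_rfl 0
    rw [mulSB_charFn_zero] at h1 h2
    rw [h1, h2]
    congr 1
    ext η
    by_cases hη : ‖η‖ ≤ R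
    · rw [indicator_of_mem (by simpa using hη.trans (by simpa using hRk k hk)),
        indicator_of_mem (by simpa using hη.trans (by simpa using hRk k₀ le_rfl))]
    · have h3 := hzero u hu η 0 (Or.inr rfl) (lt_max_of_lt_left (not_le.1 hη))
      refine Eq.trans (b := (0 : ℂ)) ?_ (Eq.symm ?_) <;>
        exact indicator_apply_eq_zero.2 fun _ => h3
  · rw [hform u k hk ξ]
    refine integral_eq_zero_of_ae (Eventually.of_forall fun η => ?_)
    exact indicator_apply_eq_zero.2 fun _ => hzero u hu η ξ (Or.inl hξ) (lt_max_of_lt_right hlt)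

theorem stationary (χ : StdChar F) (hϖ : ‖(ϖ : F)‖ < 1) (hϖΛ : ϖ ∈ Λ)
    (hf : AnalyticOnNhd F f X) (hXY : MapsTo f X Y) (hY : IsOpen Y)
    (hΓ : IsClosedConeOver Λ Y Γ) (hΓf : Γ ∩ normalSet f X = ∅)
    {U : Set (Dist Y)} (hU : UniformWF χ Λ Γ U) {W : Set (Fin m → F)} (hW : IsClosedCone Λ W)
    (φ : SB X) (hdis : pullbackCone f X Γ ∩ tsupport φ.1 ×ˢ W = ∅) :
    Stationary χ ϖ hf hXY U W φ := by
  refine SB.ball_induction ϖ.ne_zero hϖ φ ?_ ?_ ?_ ?_ ?_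
  · exact ⟨0, 0, fun u _ k _ => ⟨by simp, fun ξ _ _ => by simp⟩⟩
  · rintro a b ⟨R₁, k₁, h₁⟩ ⟨R₂, k₂, h₂⟩
    refine ⟨max R₁ R₂, max k₁ k₂, fun u hu k hk => ⟨?_, fun ξ hξ hlt => ?_⟩⟩
    · rw [map_add, map_add, (h₁ u hu k ((le_max_left _ _).trans hk)).1,
        (h₁ u hu (max k₁ k₂) (le_max_left _ _)).1, (h₂ u hu k ((le_max_right _ _).trans hk)).1,
        (h₂ u hu (max k₁ k₂) (le_max_right _ _)).1]
    · rw [map_add, map_add,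
        (h₁ u hu k ((le_max_left _ _).trans hk)).2 ξ hξ ((le_max_left _ _).trans_lt hlt),
        (h₂ u hu k ((le_max_right _ _).trans hk)).2 ξ hξ ((le_max_right _ _).trans_lt hlt),
        add_zero]
  · rintro c a ⟨R, k₀, h⟩
    refine ⟨R, k₀, fun u hu k hk => ⟨?_, fun ξ hξ hlt => ?_⟩⟩
    · rw [map_smul, map_smul, (h u hu k hk).1]
    · rw [map_smul, map_smul, (h u hu k hk).2 ξ hξ hlt, smul_zero]
  · intro x hx
    refine exists_stationary_ballSB χ hϖ hϖΛ hf hXY hY hΓ hΓf hU hW (φ.2.2.2 hx) ?_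
    intro η hη hηW
    exact (Set.eq_empty_iff_forall_notMem.1 hdis) (x, codiff f x η)
      ⟨⟨φ.2.2.2 hx, η, hη, rfl⟩, hx, hηW⟩

end Pullback
-- The limit, its wave front set, and approximation by smooth functions
section Extension

variable {F : Type*} [NontriviallyNormedField F] [IsUltrametricDist F] [ProperSpace F]
  [MeasurableSpace F] [BorelSpace F] {m n : ℕ} {Λ : Subgroup Fˣ} {ϖ : Fˣ}
  {X : Set (Fin m → F)} {Y : Set (Fin n → F)} {f : (Fin m → F) → (Fin n → F)}
  {Γ : Set ((Fin n → F) × (Fin n → F))} {χ : StdChar F}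

omit [IsUltrametricDist F] [ProperSpace F] [MeasurableSpace F] [BorelSpace F] in
theorem UniformWF.mono {Γ' : Set ((Fin n → F) × (Fin n → F))} {U : Set (Dist Y)}
    (hU : UniformWF χ Λ Γ' U) (h : Γ' ⊆ Γ) : UniformWF χ Λ Γ U := fun φ V hV hdis =>
  hU φ V hV (subset_empty_iff.1 ((inter_subset_inter_left _ h).trans hdis.subset))

omit [IsUltrametricDist F] [ProperSpace F] [MeasurableSpace F] [BorelSpace F] in
theorem UniformWF.union {U U' : Set (Dist Y)} (hU : UniformWF χ Λ Γ U)
    (hU' : UniformWF χ Λ Γ U') : UniformWF χ Λ Γ (U ∪ U') := by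
  intro φ V hV hdis
  obtain ⟨R, hR⟩ := hU φ V hV hdis
  obtain ⟨R', hR'⟩ := hU' φ V hV hdis
  refine ⟨max R R', ?_⟩
  rintro u (hu | hu) ξ hξ hlt
  · exact hR u hu ξ hξ ((le_max_left _ _).trans_lt hlt)
  · exact hR' u hu ξ hξ ((le_max_right _ _).trans_lt hlt)

omit [IsUltrametricDist F] [ProperSpace F] [MeasurableSpace F] [BorelSpace F] in
theorem isClosedCone_empty : IsClosedCone Λ (∅ : Set (Fin m → F)) :=
  ⟨⟨by simp, by simp⟩, by simp⟩

/-- `v` is the limit of the regularized pullbacks of `u`. -/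
def IsPullback (ϖ : Fˣ) (hf : AnalyticOnNhd F f X) (hXY : MapsTo f X Y) (u : Dist Y)
    (v : Dist X) : Prop :=
  ∀ φ : SB X, Tendsto (fun k : ℕ => regPullback hf hXY (‖(ϖ : F)‖ ^ k) u φ) atTop (𝓝 (v φ))

variable {hf : AnalyticOnNhd F f X} {hXY : MapsTo f X Y}

theorem IsPullback.unique {u : Dist Y} {v v' : Dist X}
    (h : IsPullback ϖ hf hXY u v) (h' : IsPullback ϖ hf hXY u v') : v = v' :=
  LinearMap.ext fun φ => tendsto_nhds_unique (h φ) (h' φ)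

/-- Limits of eventually constant sequences inherit their values. One `k₀` serves all of `U`, which
is the source of continuity. -/
theorem Stationary.exists_bound {U : Set (Dist Y)} {W : Set (Fin m → F)} {φ : SB X}
    (h : Stationary χ ϖ hf hXY U W φ) :
    ∃ (R : ℝ) (k₀ : ℕ), ∀ u ∈ U, ∀ v, IsPullback ϖ hf hXY u v →
      v φ = regPullback hf hXY (‖(ϖ : F)‖ ^ k₀) u φ ∧
      ∀ ξ ∈ W, R < ‖ξ‖ → fourierMul χ φ v ξ = 0 := by
  obtain ⟨R, k₀, h⟩ := h
  refine ⟨R, k₀, fun u hu v hv => ⟨?_, fun ξ hξ hlt => ?_⟩⟩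
  · refine tendsto_nhds_unique (hv φ) (tendsto_const_nhds.congr' ?_)
    filter_upwards [eventually_ge_atTop k₀] with k hk
    exact (h u hu k hk).1.symm
  · refine tendsto_nhds_unique (hv _) (tendsto_const_nhds.congr' ?_)
    filter_upwards [eventually_ge_atTop k₀] with k hk
    exact ((h u hu k hk).2 ξ hξ hlt).symm

theorem exists_isPullback (hϖ : ‖(ϖ : F)‖ < 1) (hϖΛ : ϖ ∈ Λ) (hY : IsOpen Y)
    (hΓ : IsClosedConeOver Λ Y Γ) (hΓf : Γ ∩ normalSet f X = ∅) {u : Dist Y}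
    (hu : UniformWF χ Λ Γ {u}) : ∃ v, IsPullback ϖ hf hXY u v := by
  have h : ∀ φ : SB X, ∃ c,
      Tendsto (fun k : ℕ => regPullback hf hXY (‖(ϖ : F)‖ ^ k) u φ) atTop (𝓝 c) := by
    intro φ
    -- Existence of the limit concerns the frequency `ξ = 0` only, so `W = ∅` suffices.
    obtain ⟨R, k₀, h⟩ := stationary χ hϖ hϖΛ hf hXY hY hΓ hΓf hu isClosedCone_empty φ (by simp)
    refine ⟨regPullback hf hXY (‖(ϖ : F)‖ ^ k₀) u φ, tendsto_const_nhds.congr' ?_⟩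
    filter_upwards [eventually_ge_atTop k₀] with k hk
    exact (h u rfl k hk).1.symm
  choose c hc using h
  exact ⟨linearMapOfTendsto c (fun k => regPullback hf hXY (‖(ϖ : F)‖ ^ k) u)
    (tendsto_pi_nhds.2 hc), hc⟩

/-- Stationarity is applied with the wave front set of `u` itself in place of `Γ`. Since its
pullback is closed, a point outside has a product neighbourhood outside, which supplies both `φ` and
the cone `W`. -/
theorem IsPullback.WF_subset (hϖ : ‖(ϖ : F)‖ < 1) (hϖΛ : ϖ ∈ Λ) (hX : IsOpen X) (hY : IsOpen Y)
    {u : Dist Y} (hu : WF χ Λ u ∩ normalSet f X = ∅) {v : Dist X}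
    (hv : IsPullback ϖ hf hXY u v) : WF χ Λ v ⊆ pullbackCone f X (WF χ Λ u) := by
  rintro ⟨x, ξ⟩ ⟨hx, hξ, h⟩
  by_contra hnot
  have hΓ := isClosedConeOver_WF (Λ := Λ) χ u
  have hΓ' := isClosedConeOver_pullbackCone hϖ hϖΛ hf hXY hY hΓ hu
  have hcl : (closure (pullbackCone f X (WF χ Λ u)))ᶜ ∈ 𝓝 (x, ξ) :=
    isClosed_closure.isOpen_compl.mem_nhds fun hmem => hnot (hΓ'.closed ⟨hmem, hx, hξ⟩)
  obtain ⟨A, B, hA, hxA, hB, hξB, hAB⟩ := mem_nhds_prod_iff'.1 hcl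
  obtain ⟨r, hr, hrA⟩ := Metric.nhds_basis_closedBall.mem_iff.1
    (Filter.inter_mem (hA.mem_nhds hxA) (hX.mem_nhds hx))
  have hrX : Metric.closedBall x r ⊆ X := fun z hz => (hrA hz).2
  obtain ⟨ε, hε0, hε1, hε⟩ := exists_thick_orbit (Λ := Λ) hB hξB hξ
  have hcone := isCone_orbit (Λ := Λ) hξ
  set W := thick (orbit Λ ξ) ε
  set φ := ballSB X r x
  have hst : Stationary χ ϖ hf hXY {u} W φ := by
    refine stationary χ hϖ hϖΛ hf hXY hY hΓ hu (uniformWF_singleton χ hϖ hϖΛ u)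
      (isClosedCone_thick hε0 hε1 hcone) φ (Set.eq_empty_iff_forall_notMem.2 ?_)
    rintro ⟨z, ζ⟩ ⟨h1, h2, h3⟩
    obtain ⟨l, hl, h4⟩ := hε ζ h3
    rw [SB.mem_tsupport, ballSB_apply hr hrX] at h2
    have h5 : z ∈ A := (hrA (by_contra fun h => h2 (indicator_of_notMem h _))).1
    exact hAB (mk_mem_prod h5 h4) (subset_closure ((hΓ'.cone l hl _ _).1 h1))
  obtain ⟨R, k₀, hR⟩ := hst.exists_bound
  have h1 := h φ (by
    rw [ballSB_apply hr hrX, indicator_of_mem (Metric.mem_closedBall_self hr.le)]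
    exact one_ne_zero)
  refine h1.2 W (isOpen_thick hε0 hε1 hcone) (isCone_thick hcone)
    (subset_thick hε0 hcone (mem_orbit_self ξ)) ?_
  rw [isBounded_tsupport_fourierMul_inter_iff]
  exact ⟨R, (hR u rfl v hv).2⟩

/-- On the compact set `f(supp φ)` the function `g` is constant on balls of a uniform radius, so its
means over smaller balls equal `g`. -/
theorem isPullback_ofSmooth (hϖ : ‖(ϖ : F)‖ < 1) (hY : IsOpen Y) (g : Smooth Y) :
    IsPullback ϖ hf hXY (ofSmooth g) (ofSmooth (pullbackSmooth hf hXY g)) := by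
  intro φ
  have hK : IsCompact (f '' tsupport φ.1) :=
    φ.2.2.1.isCompact.image_of_continuousOn fun x hx =>
      (hf x (φ.2.2.2 hx)).continuousAt.continuousWithinAt
  have hKY : f '' tsupport φ.1 ⊆ Y := by
    rintro _ ⟨x, hx, rfl⟩
    exact hXY (φ.2.2.2 hx)
  have hloc : ∀ y ∈ f '' tsupport φ.1, ∃ δ > 0, ∀ z ∈ Metric.ball y δ, g.1 z = g.1 y ∧ z ∈ Y := by
    intro y hy
    exact Metric.eventually_nhds_iff.1 ((g.2 y (hKY hy)).and (hY.mem_nhds (hKY hy)))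
  choose! δ hδ hg using hloc
  obtain ⟨s, hs, hs'⟩ := lebesgue_number_lemma_of_metric
    (c := fun y : f '' tsupport φ.1 => Metric.ball y.1 (δ y.1))
    hK (fun _ => Metric.isOpen_ball)
    (fun y hy => mem_iUnion.2 ⟨⟨y, hy⟩, Metric.mem_ball_self (hδ y hy)⟩)
  obtain ⟨k₀, hk₀⟩ := exists_pow_lt_of_lt_one hs hϖ
  have hϖ0 : 0 < ‖(ϖ : F)‖ := norm_pos_iff.2 ϖ.ne_zero
  refine tendsto_const_nhds.congr' ?_
  filter_upwards [eventually_ge_atTop k₀] with k hk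
  have hr : 0 < ‖(ϖ : F)‖ ^ k := by positivity
  have hrs : ‖(ϖ : F)‖ ^ k < s := (pow_le_pow_of_le_one hϖ0.le hϖ.le hk).trans_lt hk₀
  rw [regPullback_apply, ofSmooth_apply]
  congr 1
  ext x
  by_cases hx : φ.1 x = 0
  · simp [hx]
  congr 1
  obtain ⟨⟨y, hy⟩, hyx⟩ := hs' (f x) ⟨x, subset_tsupport _ hx, rfl⟩
  have hball : ∀ z ∈ Metric.closedBall (f x) (‖(ϖ : F)‖ ^ k), g.1 z = g.1 (f x) ∧ z ∈ Y := by
    intro z hz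
    have h1 := hg y hy z (hyx (Metric.closedBall_subset_ball hrs hz))
    have h2 := hg y hy (f x) (hyx (Metric.mem_ball_self hs))
    exact ⟨h1.1.trans h2.1.symm, h1.2⟩
  have h1 : ∀ z, g.1 z * (ballSB Y (‖(ϖ : F)‖ ^ k) (f x)).1 z =
      (Metric.closedBall (f x) (‖(ϖ : F)‖ ^ k)).indicator (fun _ => g.1 (f x)) z := by
    intro z
    rw [ballSB_apply hr fun z hz => (hball z hz).2]
    by_cases hz : z ∈ Metric.closedBall (f x) (‖(ϖ : F)‖ ^ k)
    · rw [indicator_of_mem hz, indicator_of_mem hz, mul_one, (hball z hz).1]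
    · rw [indicator_of_notMem hz, indicator_of_notMem hz, mul_zero]
  rw [ofSmooth_apply]
  simp_rw [h1]
  rw [integral_indicator_const _ Metric.isClosed_closedBall.measurableSet,
    Measure.addHaar_real_closedBall_center, Complex.real_smul]
  change g.1 (f x) = (ballVol F n (‖(ϖ : F)‖ ^ k))⁻¹ * (ballVol F n (‖(ϖ : F)‖ ^ k) * g.1 (f x))
  rw [inv_mul_cancel_left₀ (ballVol_pow_ne_zero ϖ.ne_zero k)]

/-- The regularizations of a distribution converge to it in `𝓢^*_Γ(Y)`. -/
theorem convergesTo_reg (hϖ : ‖(ϖ : F)‖ < 1) (hϖΛ : ϖ ∈ Λ) (hY : IsOpen Y)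
    (hΓ : IsClosedConeOver Λ Y Γ)
    (hreg : ∀ g : Smooth Y, ofSmooth g ∈ DistWF χ Λ Y Γ) (u : DistWF χ Λ Y Γ) :
    ConvergesTo χ Λ (fun k : ℕ => ⟨ofSmooth (reg (‖(ϖ : F)‖ ^ k) u.1), hreg _⟩) u := by
  have hϖ0 : 0 < ‖(ϖ : F)‖ := norm_pos_iff.2 ϖ.ne_zero
  refine ⟨fun φ => ?_, fun φ V hV hdis => ?_⟩
  · obtain ⟨s, hs, h⟩ := SB.exists_mean φ
    obtain ⟨k₀, hk₀⟩ := exists_pow_lt_of_lt_one hs hϖ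
    refine tendsto_const_nhds.congr' ?_
    filter_upwards [eventually_ge_atTop k₀] with k hk
    have h1 := (h (‖(ϖ : F)‖ ^ k) (by positivity)
      ((pow_le_pow_of_le_one hϖ0.le hϖ.le hk).trans hk₀.le)).2.2 u.1
    rw [ofSmooth_apply]
    change _ = ∫ y, (ballVol F n (‖(ϖ : F)‖ ^ k))⁻¹ * u.1 (ballSB Y (‖(ϖ : F)‖ ^ k) y) *
      φ.1 y ∂haar F n
    simp_rw [mul_assoc]
    rw [integral_const_mul, h1, inv_mul_cancel_left₀ (ballVol_pow_ne_zero ϖ.ne_zero k)]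
  -- Stationarity for `f = id` bounds the Fourier supports for `k ≥ k₀`; each of the finitely many
  -- remaining regularizations is smooth and has its own bound.
  · have hid : AnalyticOnNhd F (id : (Fin n → F) → (Fin n → F)) Y := analyticOnNhd_id
    obtain ⟨R, k₀, h⟩ := stationary (f := id) χ hϖ hϖΛ hid (mapsTo_id Y) hY hΓ (by
        refine Set.eq_empty_iff_forall_notMem.2 ?_
        rintro z ⟨-, x, -, -, h1, h2⟩
        rw [codiff_id] at h2
        exact h1 h2)
      ((uniformWF_singleton χ hϖ hϖΛ u.1).mono u.2) hV φ (by
        refine Set.eq_empty_iff_forall_notMem.2 ?_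
        rintro ⟨x, ξ⟩ ⟨⟨-, η, hη, h1⟩, h2⟩
        simp only [codiff_id, id] at h1 hη
        rw [← h1] at hη
        exact (Set.eq_empty_iff_forall_notMem.1 hdis) (x, ξ) ⟨hη, h2⟩)
    choose R' hR' using fun k : ℕ => exists_fourierMul_ofSmooth_eq_zero χ ϖ.ne_zero hϖ
      (reg (‖(ϖ : F)‖ ^ k) u.1) φ
    obtain ⟨M, hM⟩ := ((Finset.range k₀).image R').exists_le
    refine (isBounded_iUnion_tsupport_inter_iff χ φ _ V).2 ⟨max R M, fun k ξ hξ hlt => ?_⟩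
    rcases lt_or_ge k k₀ with hk | hk
    · refine hR' k ξ (lt_of_le_of_lt ?_ ((le_max_right _ _).trans_lt hlt))
      exact hM _ (Finset.mem_image_of_mem _ (Finset.mem_range.2 hk))
    · exact (h u.1 rfl k hk).2 ξ hξ ((le_max_left _ _).trans_lt hlt)

end Extension
end PadicWF

/-! ### The extension theorem -/

theorem mainTheorem11 {F : Type*} [NontriviallyNormedField F] [IsUltrametricDist F]
    [ProperSpace F] [CharZero F] [MeasurableSpace F] [BorelSpace F]
    (χ : PadicWF.StdChar F)
    (Λ : Subgroup Fˣ) (hΛ : Λ.FiniteIndex)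
    (ϖ : Fˣ) (hϖ : PadicWF.IsPrimeElement ϖ) (hϖΛ : ϖ ∈ Λ)
    {m n : ℕ} (X : Set (Fin m → F)) (hX : IsOpen X) (Y : Set (Fin n → F)) (hY : IsOpen Y)
    (f : (Fin m → F) → (Fin n → F)) (hf : AnalyticOnNhd F f X) (hXY : Set.MapsTo f X Y)
    (Γ : Set ((Fin n → F) × (Fin n → F))) (hΓ : PadicWF.IsClosedConeOver Λ Y Γ)
    (hΓf : Γ ∩ PadicWF.normalSet f X = ∅) :
    (∀ g : PadicWF.Smooth Y, PadicWF.ofSmooth g ∈ PadicWF.DistWF χ Λ Y Γ) ∧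
    PadicWF.IsClosedConeOver Λ X (PadicWF.pullbackCone f X Γ) ∧
    ∃ T : PadicWF.DistWF χ Λ Y Γ → PadicWF.DistWF χ Λ X (PadicWF.pullbackCone f X Γ),
      (PadicWF.ExtendsPullback χ Λ hf hXY T ∧ PadicWF.IsContinuous χ Λ T) ∧
      (∀ T' : PadicWF.DistWF χ Λ Y Γ → PadicWF.DistWF χ Λ X (PadicWF.pullbackCone f X Γ),
        PadicWF.ExtendsPullback χ Λ hf hXY T' ∧ PadicWF.IsContinuous χ Λ T' → T' = T) ∧
      ∀ u : PadicWF.DistWF χ Λ Y Γ,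
        PadicWF.WF χ Λ (T u).1 ⊆ PadicWF.pullbackCone f X (PadicWF.WF χ Λ u.1) := by
  open PadicWF in
  have hϖ1 : ‖(ϖ : F)‖ < 1 := hϖ.1
  have hreg : ∀ g : Smooth Y, ofSmooth g ∈ DistWF χ Λ Y Γ := fun g => by
    change WF χ Λ (ofSmooth g) ⊆ Γ
    rw [WF_ofSmooth χ hϖ1 hY g]
    exact empty_subset _
  refine ⟨hreg, isClosedConeOver_pullbackCone hϖ1 hϖΛ hf hXY hY hΓ hΓf, ?_⟩
  have hUni : ∀ u : DistWF χ Λ Y Γ, UniformWF χ Λ Γ {u.1} := fun u =>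
    (uniformWF_singleton χ hϖ1 hϖΛ u.1).mono u.2
  have hWF : ∀ (u : DistWF χ Λ Y Γ) v, IsPullback ϖ hf hXY u.1 v →
      WF χ Λ v ⊆ pullbackCone f X (WF χ Λ u.1) := fun u v hv =>
    hv.WF_subset hϖ1 hϖΛ hX hY
      (subset_empty_iff.1 ((inter_subset_inter_left _ u.2).trans hΓf.subset))
  have hex : ∀ u : DistWF χ Λ Y Γ, ∃ v : DistWF χ Λ X (pullbackCone f X Γ),
      IsPullback ϖ hf hXY u.1 v.1 := by
    intro u
    obtain ⟨v, hv⟩ := exists_isPullback (hf := hf) (hXY := hXY) hϖ1 hϖΛ hY hΓ hΓf (hUni u)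
    refine ⟨⟨v, (hWF u v hv).trans ?_⟩, hv⟩
    rintro z ⟨hz, η, hη, h⟩
    exact ⟨hz, η, u.2 hη, h⟩
  choose T hT using hex
  refine ⟨T, ⟨fun g hg => (hT _).unique (isPullback_ofSmooth hϖ1 hY g), ?_⟩, ?_,
    fun u => hWF u _ (hT u)⟩
  · intro u v huv
    -- Including the limit `v` gives one `k₀` for the sequence and its limit.
    have hU : UniformWF χ Λ Γ (range (fun j => (u j).1) ∪ {v.1}) := by
      refine UniformWF.union ?_ (hUni v)
      intro φ V hV hdis
      obtain ⟨R, hR⟩ := (isBounded_iUnion_tsupport_inter_iff χ φ _ V).1 (huv.2 φ V hV hdis)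
      refine ⟨R, ?_⟩
      rintro _ ⟨j, rfl⟩
      exact hR j
    refine ⟨fun φ => ?_, fun φ V hV hdis => ?_⟩
    · obtain ⟨R, k₀, h⟩ := (stationary χ hϖ1 hϖΛ hf hXY hY hΓ hΓf hU isClosedCone_empty φ
        (by simp)).exists_bound
      -- With `k₀` fixed, testing the pullbacks against `φ` amounts to testing the original
      -- distributions against one `w`, so weak convergence is inherited.
      obtain ⟨w, hw⟩ := exists_regPullback_eq hf hXY
        (pow_pos (norm_pos_iff.2 ϖ.ne_zero) k₀) φ
      have h1 : ∀ j, (T (u j)).1 φ = (u j).1 w := fun j =>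
        ((h _ (Or.inl ⟨j, rfl⟩) _ (hT (u j))).1).trans (hw _)
      have h2 : (T v).1 φ = v.1 w := ((h _ (Or.inr rfl) _ (hT v)).1).trans (hw _)
      simp only [h1, h2]
      exact huv.1 w
    · obtain ⟨R, k₀, h⟩ := (stationary χ hϖ1 hϖΛ hf hXY hY hΓ hΓf hU hV φ hdis).exists_bound
      exact (isBounded_iUnion_tsupport_inter_iff χ φ _ V).2
        ⟨R, fun j => (h _ (Or.inl ⟨j, rfl⟩) _ (hT (u j))).2⟩
  · rintro T' ⟨hext, hcont⟩
    funext u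
    refine Subtype.ext (LinearMap.ext fun φ => ?_)
    -- On the regularizations `T'` is prescribed, and these prescribed values converge to `T u` by
    -- construction.
    have h1 := (hcont _ _ (convergesTo_reg hϖ1 hϖΛ hY hΓ hreg u)).1 φ
    refine tendsto_nhds_unique (h1.congr fun k => ?_) (hT u φ)
    exact LinearMap.congr_fun (hext (reg (‖(ϖ : F)‖ ^ k) u.1) (hreg _)) φ
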